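/- Let $T>0$, $\Omega_T=(0,1)\times(0,T)$, and let $H^{1/2}(0,T)$ be the space of measurable $h:(0,T)\to\mathbb C$ (modulo null sets) with $$\|h\|_{H^{1/2}(0,T)}^2=\int_0^T|h(t)|^2\,dt+\int_0^T\!\!\int_0^T\frac{|h(t)-h(s)|^2}{|t-s|^2}\,ds\,dt<\infty .$$ For $h\in H^{1/2}(0,T)$ and $t\in[0,T]$ put $$u_h(x,t)=\sum_{n=1}^{\infty}2in\pi\,e^{-i(n\pi)^2t}\int_0^t e^{i(n\pi)^2\tau}h(\tau)\,d\tau\;\sin n\pi x ,\qquad x\in(0,1),$$ the series being taken in $L^2(0,1)$. There is a constant $C_T$, depending only on $T$, such that for every $h\in H^{1/2}(0,T)$ the series converges in $L^2(0,1)$ for every $t\in[0,T]$, $$u_h\in L^4(\Omega_T)\cap C([0,T];L^2(0,1)),$$ $$\|u_h\|_{L^4(\Omega_T)}\le C_T\|h\|_{H^{1/2}(0,T)}\qquad\text{and}\qquad \sup_{0\le t\le T}\|u_h(\cdot,t)\|_{L^2(0,1)}\le C_T\|h\|_{H^{1/2}(0,T)} .$$ -/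

import Mathlib

open MeasureTheory Set
open scoped ENNReal NNReal

noncomputable section

/-- The Sobolev–Slobodeckij norm of `H^{1/2}(0,T)`, with values in `[0,∞]`:
`‖h‖² = ∫₀ᵀ |h(t)|² dt + ∫₀ᵀ ∫₀ᵀ |h(t) - h(s)|² / |t - s|² ds dt`
(the integrand of the double integral is `0` on the diagonal). -/
def eSobolevHalfNorm (T : ℝ) (h : ℝ → ℂ) : ℝ≥0∞ :=
  ((∫⁻ t in Ioo 0 T, ‖h t‖ₑ ^ 2) +
    ∫⁻ t in Ioo 0 T, ∫⁻ s in Ioo 0 T, ‖h t - h s‖ₑ ^ 2 / ‖t - s‖ₑ ^ 2) ^ (1 / 2 : ℝ)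

/-- `h ∈ H^{1/2}(0,T)`: `h` is (a.e. strongly) measurable on `(0,T)` and its norm is finite.
Only the restriction of `h` to `(0,T)`, up to null sets, matters. -/
def MemSobolevHalf (T : ℝ) (h : ℝ → ℂ) : Prop :=
  AEStronglyMeasurable h (volume.restrict (Ioo 0 T)) ∧ eSobolevHalfNorm T h < ∞

/-- The space `L²(0,1)` of complex-valued functions. -/
abbrev L2Unit : Type := Lp ℂ 2 (volume.restrict (Ioo (0 : ℝ) 1))

theorem memLp_sineMode (n : ℕ) :
    MemLp (fun x : ℝ => ((Real.sin (n * Real.pi * x) : ℝ) : ℂ)) 2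
      (volume.restrict (Ioo (0 : ℝ) 1)) := by
  refine MemLp.of_bound (Continuous.aestronglyMeasurable (by fun_prop)) 1 ?_
  filter_upwards with x
  rw [Complex.norm_real]
  exact Real.abs_sin_le_one _

/-- The function `x ↦ sin (nπx)` as an element of `L²(0,1)`. -/
def sineMode (n : ℕ) : L2Unit := (memLp_sineMode n).toLp _

/-- The coefficient `2 i n π e^{-i(nπ)²t} ∫₀ᵗ e^{i(nπ)²τ} h(τ) dτ`. -/
def boundaryCoeff (h : ℝ → ℂ) (n : ℕ) (t : ℝ) : ℂ :=
  2 * Complex.I * n * Real.pi * Complex.exp (-Complex.I * ((n * Real.pi : ℝ) : ℂ) ^ 2 * t) *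
    ∫ τ in (0 : ℝ)..t, Complex.exp (Complex.I * ((n * Real.pi : ℝ) : ℂ) ^ 2 * τ) * h τ

/-- The boundary integral `u_h(·,t) = (W_h h)(t) = ∑_{n ≥ 1} (boundaryCoeff h n t) sin (nπ·)`, the
series being taken in `L²(0,1)`; the term with `n = 0` is zero. -/
def boundaryIntegral (h : ℝ → ℂ) (t : ℝ) : L2Unit :=
  ∑' n : ℕ, boundaryCoeff h n t • sineMode n

end

/-! The idea is to make time periodic with a period adapted to the free Schrödinger frequencies.
With `P = 2M/π`, the frequency `(nπ)²` is the integer multiple `M n²` of `2π/P`, and taking `M =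
⌈πT⌉` gives `2T ≤ P`. Reflecting `h` through a tent function gives a `P`-periodic extension whose
Fourier coefficients satisfy `∑ (1+|k|)|a_k|² ≤ C‖h‖²` (`exists_halfEnergy_tentExtension_le`): the
tent contracts distances, and Parseval applied to translates recovers the weight `|k|` from the
double integral.

Integrating the Fourier series term by term (`boundaryCoeff_eq_modeCoeff`) splits the `n`-th
coefficient into a resonant term, proportional to `t n a_{-Mn²} e^{-i(nπ)²t}`, and the sum over the
other `k` of `P n a_k/(k+Mn²)` times the difference of the `k`-th phase and the free phase. The
denominators are treated in two regimes. Near, `Mn² ≤ 2|k|`: the factor `n²` is paid for by the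
weight of `a_k`, and the values `k+Mn²` are quadratically sparse in `n`, leaving a weight
`⟨k+Mn²⟩^{5/4}` to spare. Far, `2|k| < Mn²`: the denominator is of size at least `n²/2`, so the
coefficient decays almost like `1/n`.

These bounds give a majorant of the coefficients that is square summable in `n` and independent of
`t` (`exists_modeCoeff_bound`). Orthogonality of the sines then gives convergence, continuity into
`L²` and the supremum bound.

For `L⁴` (`exists_eLpNorm_modeCoeff_le`), the resonant term and the subtracted free phases are
controlled by the periodic Strichartz estimate `eLpNorm_sum_schrodinger_le`. The near part,
regrouped by `l = k+Mn²`, is a sum over `l` of a unimodular phase times a free solution, so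
Strichartz applies for each `l`. The far part, grouped by `k`, is a sum of phases times sine series
in `x` alone, for which a Sobolev embedding of order `3/10` suffices. Finally
`exists_joint_representative` turns the curve in `L²(0,1)` into a function of `(x,t)`, and Fatou
carries the bound over. -/

noncomputable section

/-! ### Weighted sums over the integers. -/

/-- The Cauchy–Schwarz inequality for series in `[0,∞]`. -/
theorem ENNReal.tsum_mul_sq_le {ι : Type*} (f g : ι → ℝ≥0∞) :
    (∑' i, f i * g i) ^ 2 ≤ (∑' i, f i ^ 2) * ∑' i, g i ^ 2 := by
  let _ : MeasurableSpace ι := ⊤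
  have h := ENNReal.lintegral_mul_le_Lp_mul_Lq (Measure.count : Measure ι)
    (Real.HolderConjugate.two_two) (f := f) (g := g)
    (measurable_from_top.aemeasurable) (measurable_from_top.aemeasurable)
  simp only [lintegral_count, Pi.mul_apply] at h
  calc (∑' i, f i * g i) ^ 2 ≤ ((∑' i, f i ^ (2 : ℝ)) ^ (1 / 2 : ℝ) *
        (∑' i, g i ^ (2 : ℝ)) ^ (1 / 2 : ℝ)) ^ 2 := by gcongr
    _ = _ := by
      rw [mul_pow, ← ENNReal.rpow_natCast, ← ENNReal.rpow_natCast, ← ENNReal.rpow_mul,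
        ← ENNReal.rpow_mul]
      norm_num

/-- The weight `1 + |k|`. -/
def bracket (k : ℤ) : ℝ≥0∞ := ((k.natAbs + 1 : ℕ) : ℝ≥0∞)

theorem bracket_ne_zero (k : ℤ) : bracket k ≠ 0 := by
  simp [bracket]

theorem bracket_ne_top (k : ℤ) : bracket k ≠ ∞ := by
  simp [bracket]

theorem bracket_rpow_add (k : ℤ) (a b : ℝ) :
    bracket k ^ a * bracket k ^ b = bracket k ^ (a + b) :=
  (ENNReal.rpow_add a b (bracket_ne_zero k) (bracket_ne_top k)).symm

theorem tsum_bracket_rpow_ne_top {s : ℝ} (hs : 1 < s) :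
    ∑' k : ℤ, bracket k ^ (-s) ≠ ∞ := by
  have h1 : ∀ k : ℤ, bracket k ^ (-s) = ENNReal.ofReal (((k.natAbs : ℝ) + 1) ^ (-s)) := by
    intro k
    rw [← ENNReal.ofReal_rpow_of_pos (by positivity)]
    congr 1
    rw [bracket, ← ENNReal.ofReal_natCast]
    push_cast
    rfl
  simp only [h1]
  have h3 : Summable fun n : ℕ => ((n : ℝ) + 1) ^ (-s) := by
    have := (summable_nat_add_iff 1).2 (Real.summable_nat_rpow.2 (show -s < -1 by linarith))
    simpa using this
  have h2 : Summable fun k : ℤ => (((k.natAbs : ℝ) + 1) ^ (-s)) := by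
    refine Summable.of_nat_of_neg ?_ ?_ <;> simpa using h3
  exact (ENNReal.ofReal_tsum_of_nonneg (fun k => by positivity) h2) ▸ ENNReal.ofReal_ne_top

/-- The distance from an integer to the values of `M n²` grows quadratically in `n`. -/
theorem exists_sq_le_quadratic (M : ℕ) (hM : 1 ≤ M) (k : ℤ) :
    ∃ m : ℤ, ∀ n : ℕ, ((((n : ℤ) - m).natAbs + 1 : ℕ) : ℝ) ^ 2 ≤
      16 * (((k + M * n ^ 2).natAbs + 1 : ℕ) : ℝ) := by
  -- `r` is the nonnegative root of `k + M x²`, or `0` when `k ≥ 0`, by the convention for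
  -- `Real.sqrt`. As `r ≥ 0`, `|n - r|² ≤ |n - r|(n + r)`, which is at most `|k + M n²|`. Rounding
  -- `r` down costs at most one, absorbed in the constant 16.
  set r : ℝ := Real.sqrt (-k / M) with hr
  have hM0 : (1 : ℝ) ≤ M := by exact_mod_cast hM
  have hr0 : 0 ≤ r := Real.sqrt_nonneg _
  refine ⟨⌊r⌋, fun n => ?_⟩
  have key : (|(n : ℝ) - r|) ^ 2 ≤ |((k + M * n ^ 2 : ℤ) : ℝ)| := by
    push_cast
    have hn : (0 : ℝ) ≤ n := by positivity
    rcases le_total (0 : ℤ) k with hk | hk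
    · have hk' : (0 : ℝ) ≤ k := by exact_mod_cast hk
      have : r = 0 := Real.sqrt_eq_zero_of_nonpos (div_nonpos_of_nonpos_of_nonneg (by linarith)
        (by linarith))
      rw [this, sub_zero, abs_of_nonneg hn, abs_of_nonneg (by positivity)]
      nlinarith [sq_nonneg (n : ℝ)]
    · have hk' : (k : ℝ) ≤ 0 := by exact_mod_cast hk
      have h2 : r ^ 2 = -k / M := Real.sq_sqrt (div_nonneg (by linarith) (by linarith))
      have h3 : (k : ℝ) + M * n ^ 2 = M * ((n - r) * (n + r)) := by
        have : (k : ℝ) = - (M * r ^ 2) := by rw [h2]; field_simp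
        rw [this]; ring
      rw [h3, abs_mul, abs_mul, abs_of_nonneg (show (0 : ℝ) ≤ M by linarith),
        abs_of_nonneg (show 0 ≤ (n : ℝ) + r by linarith)]
      have h4 : |(n : ℝ) - r| ≤ n + r := by
        rw [abs_le]; constructor <;> linarith
      nlinarith [abs_nonneg ((n : ℝ) - r), mul_nonneg (abs_nonneg ((n : ℝ) - r))
        (show 0 ≤ (n : ℝ) + r by linarith)]
  have hd : (((n : ℤ) - ⌊r⌋).natAbs : ℝ) ≤ |(n : ℝ) - r| + 1 := by
    rw [Nat.cast_natAbs, Int.cast_abs]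
    push_cast
    have h1 := Int.floor_le r
    have h2 := (Int.lt_floor_add_one r).le
    have h3 := le_abs_self ((n : ℝ) - r)
    have h4 := neg_abs_le ((n : ℝ) - r)
    rw [abs_le]; constructor <;> linarith
  have hl : (((k + M * n ^ 2).natAbs : ℕ) : ℝ) = |((k + M * n ^ 2 : ℤ) : ℝ)| := by
    rw [Nat.cast_natAbs, Int.cast_abs]
  push_cast at hl key ⊢
  rw [hl]
  have := abs_nonneg ((n : ℝ) - r)
  have hd0 : (0 : ℝ) ≤ (((n : ℤ) - ⌊r⌋).natAbs : ℝ) := by positivity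
  nlinarith [sq_nonneg (|(n : ℝ) - r| - 1)]

/-- Uniform summability along translates of the sequence `M n²`. -/
theorem exists_tsum_bracket_quadratic_le : ∃ C : ℝ≥0, ∀ (M : ℕ), 1 ≤ M → ∀ k : ℤ,
    ∑' n : ℕ, bracket (k + M * n ^ 2) ^ (-(3 / 4) : ℝ) ≤ C := by
  set S : ℝ≥0∞ := ∑' k : ℤ, bracket k ^ (-(3 / 2) : ℝ) with hS
  have hSt : S ≠ ∞ := tsum_bracket_rpow_ne_top (by norm_num)
  refine ⟨(16 ^ (3 / 4 : ℝ) * S).toNNReal, fun M hM k => ?_⟩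
  rw [ENNReal.coe_toNNReal (by finiteness)]
  obtain ⟨m, hm⟩ := exists_sq_le_quadratic M hM k
  calc ∑' n : ℕ, bracket (k + M * n ^ 2) ^ (-(3 / 4) : ℝ)
      ≤ ∑' n : ℕ, 16 ^ (3 / 4 : ℝ) * bracket ((n : ℤ) - m) ^ (-(3 / 2) : ℝ) := by
        refine ENNReal.tsum_le_tsum fun n => ?_
        have h1 : bracket ((n : ℤ) - m) ^ (2 : ℝ) ≤ 16 * bracket (k + M * n ^ 2) := by
          have h := hm n
          have h' : (((n : ℤ) - m).natAbs + 1) ^ 2 ≤ 16 * ((k + M * n ^ 2).natAbs + 1) := by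
            exact_mod_cast h
          rw [ENNReal.rpow_ofNat, bracket, bracket]
          exact_mod_cast h'
        have h2 : bracket ((n : ℤ) - m) ^ (3 / 2 : ℝ) ≤
            16 ^ (3 / 4 : ℝ) * bracket (k + M * n ^ 2) ^ (3 / 4 : ℝ) := by
          have := ENNReal.rpow_le_rpow h1 (show (0 : ℝ) ≤ 3 / 4 by norm_num)
          rw [← ENNReal.rpow_mul, ENNReal.mul_rpow_of_nonneg _ _ (by norm_num)] at this
          convert this using 2; norm_num
        rw [ENNReal.rpow_neg, ENNReal.rpow_neg]
        rw [← div_eq_mul_inv, ENNReal.le_div_iff_mul_le, mul_comm, ← div_eq_mul_inv]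
        · refine ENNReal.div_le_of_le_mul h2
        · left
          exact (ENNReal.rpow_pos (by simp [pos_iff_ne_zero, bracket_ne_zero])
            (bracket_ne_top _)).ne'
        · left
          exact ENNReal.rpow_ne_top_of_nonneg (by norm_num) (bracket_ne_top _)
    _ = 16 ^ (3 / 4 : ℝ) * ∑' n : ℕ, bracket ((n : ℤ) - m) ^ (-(3 / 2) : ℝ) := by
        rw [ENNReal.tsum_mul_left]
    _ ≤ _ := by
        gcongr
        exact ENNReal.tsum_comp_le_tsum_of_injective (f := fun n : ℕ => (n : ℤ) - m)
          (fun a b h => by simpa using h) fun k : ℤ => bracket k ^ (-(3 / 2) : ℝ)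

end

/-! ### `L⁴` estimates for trigonometric sums on a torus. -/

noncomputable section

/-- A weighted Schur test: `2 x_p x_q ≤ W_p x_p²/W_q + W_q x_q²/W_p`, and the two halves have equal
sums by symmetry. It is used with pairs of frequencies as indices and their sum as `σ`. -/
theorem sum_sum_ite_mul_le {ι G : Type*} [DecidableEq G] (S : Finset ι) (σ : ι → G)
    (x W : ι → ℝ) (hW : ∀ p ∈ S, 0 < W p) (K : ℝ)
    (hK : ∀ g, ∑ p ∈ S with σ p = g, (W p)⁻¹ ≤ K) :
    ∑ p ∈ S, ∑ q ∈ S, (if σ p = σ q then x p * x q else 0) ≤ K * ∑ p ∈ S, W p * x p ^ 2 := by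
  have h1 : ∀ p ∈ S, ∑ q ∈ S, (if σ p = σ q then W p * x p ^ 2 * (W q)⁻¹ else 0) ≤
      K * (W p * x p ^ 2) := by
    intro p hp
    rw [← Finset.sum_filter, ← Finset.mul_sum, mul_comm K]
    refine mul_le_mul_of_nonneg_left ?_ (mul_nonneg (hW p hp).le (sq_nonneg _))
    simpa [eq_comm] using hK (σ p)
  have h2 : ∀ p ∈ S, ∀ q ∈ S, (if σ p = σ q then x p * x q else 0) ≤
      2⁻¹ * (if σ p = σ q then W p * x p ^ 2 * (W q)⁻¹ else 0) +
      2⁻¹ * (if σ q = σ p then W q * x q ^ 2 * (W p)⁻¹ else 0) := by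
    intro p hp q hq
    by_cases h : σ p = σ q
    · have hWp := hW p hp
      have hWq := hW q hq
      rw [if_pos h, if_pos h, if_pos h.symm]
      have : 0 ≤ (W p * x p - W q * x q) ^ 2 * (W p)⁻¹ * (W q)⁻¹ := by positivity
      have e : (W p * x p - W q * x q) ^ 2 * (W p)⁻¹ * (W q)⁻¹ =
          W p * x p ^ 2 * (W q)⁻¹ + W q * x q ^ 2 * (W p)⁻¹ - 2 * (x p * x q) := by
        field_simp
        ring
      linarith
    · have h' : ¬ σ q = σ p := fun e => h e.symm
      simp [h, h']
  calc _ ≤ ∑ p ∈ S, ∑ q ∈ S, (2⁻¹ * (if σ p = σ q then W p * x p ^ 2 * (W q)⁻¹ else 0) +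
      2⁻¹ * (if σ q = σ p then W q * x q ^ 2 * (W p)⁻¹ else 0)) :=
        Finset.sum_le_sum fun p hp => Finset.sum_le_sum fun q hq => h2 p hp q hq
    _ = ∑ p ∈ S, ∑ q ∈ S, (if σ p = σ q then W p * x p ^ 2 * (W q)⁻¹ else 0) := by
        simp only [Finset.sum_add_distrib, ← Finset.mul_sum]
        rw [Finset.sum_comm (f := fun p q => if σ q = σ p then W q * x q ^ 2 * (W p)⁻¹ else 0)]
        ring
    _ ≤ _ := by
        rw [Finset.mul_sum]
        exact Finset.sum_le_sum h1

/-- An `L⁴` bound for a lacunary sum of orthogonal characters. -/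
theorem integral_norm_pow_four_le {X G ι : Type*} [MeasurableSpace X] [AddCommGroup G]
    [DecidableEq G] {μ : Measure X} {E : G → X → ℂ} {V : ℝ} (hV : 0 ≤ V)
    (hadd : ∀ g h x, E (g + h) x = E g x * E h x)
    (hneg : ∀ g x, E (-g) x = (starRingEnd ℂ) (E g x))
    (hint : ∀ g, Integrable (E g) μ)
    (horth : ∀ g, ∫ x, E g x ∂μ = if g = 0 then (V : ℂ) else 0)
    (s : Finset ι) (γ : ι → G) (c : ι → ℂ) (w : ι → ℝ) (hw : ∀ n, 0 < w n) (K : ℝ)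
    (hK : ∀ g, ∑ p ∈ s ×ˢ s with γ p.1 + γ p.2 = g, (w p.1 * w p.2)⁻¹ ≤ K) :
    ∫ x, ‖∑ n ∈ s, c n * E (γ n) x‖ ^ 4 ∂μ ≤ V * K * (∑ n ∈ s, w n * ‖c n‖ ^ 2) ^ 2 := by
  set S := s ×ˢ s
  set C : ι × ι → ℂ := fun p => c p.1 * c p.2
  set σ : ι × ι → G := fun p => γ p.1 + γ p.2
  have hsq : ∀ x, (∑ n ∈ s, c n * E (γ n) x) ^ 2 = ∑ p ∈ S, C p * E (σ p) x := by
    intro x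
    rw [sq, Finset.sum_mul_sum, Finset.sum_product]
    refine Finset.sum_congr rfl fun n _ => Finset.sum_congr rfl fun m _ => ?_
    simp only [C, σ, hadd]; ring
  -- The fourth power is the square times its conjugate; after integration only pairs `p`, `q` with
  -- equal total frequency survive.
  have hexp : ∀ x, ((‖∑ n ∈ s, c n * E (γ n) x‖ ^ 4 : ℝ) : ℂ) =
      ∑ p ∈ S, ∑ q ∈ S, C p * (starRingEnd ℂ) (C q) * E (σ p + -σ q) x := by
    intro x
    have : ((‖∑ n ∈ s, c n * E (γ n) x‖ ^ 4 : ℝ) : ℂ) =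
        (∑ n ∈ s, c n * E (γ n) x) ^ 2 * (starRingEnd ℂ) ((∑ n ∈ s, c n * E (γ n) x) ^ 2) := by
      rw [Complex.mul_conj, Complex.normSq_eq_norm_sq, norm_pow]
      push_cast; ring
    rw [this, hsq, map_sum, Finset.sum_mul_sum]
    refine Finset.sum_congr rfl fun n _ => Finset.sum_congr rfl fun m _ => ?_
    rw [hadd (σ n), hneg, map_mul]; ring
  have hcalc : ((∫ x, ‖∑ n ∈ s, c n * E (γ n) x‖ ^ 4 ∂μ : ℝ) : ℂ) =
      ∑ p ∈ S, ∑ q ∈ S, if σ p = σ q then C p * (starRingEnd ℂ) (C q) * V else 0 := by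
    rw [← integral_complex_ofReal]
    simp only [hexp]
    rw [integral_finsetSum _ fun p _ => integrable_finsetSum _ fun q _ => (hint _).const_mul _]
    refine Finset.sum_congr rfl fun p _ => ?_
    rw [integral_finsetSum _ fun q _ => (hint _).const_mul _]
    refine Finset.sum_congr rfl fun q _ => ?_
    rw [integral_const_mul, horth]
    simp [← sub_eq_add_neg, sub_eq_zero]
  have hnorm : ∫ x, ‖∑ n ∈ s, c n * E (γ n) x‖ ^ 4 ∂μ ≤
      V * ∑ p ∈ S, ∑ q ∈ S, if σ p = σ q then ‖C p‖ * ‖C q‖ else 0 := by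
    calc _ ≤ ‖((∫ x, ‖∑ n ∈ s, c n * E (γ n) x‖ ^ 4 ∂μ : ℝ) : ℂ)‖ := by
          rw [Complex.norm_real]; exact le_abs_self _
      _ ≤ _ := by
        rw [hcalc, Finset.mul_sum]
        refine (norm_sum_le _ _).trans (Finset.sum_le_sum fun p _ => ?_)
        rw [Finset.mul_sum]
        refine (norm_sum_le _ _).trans (Finset.sum_le_sum fun q _ => ?_)
        split_ifs
        · simp [abs_of_nonneg hV, mul_comm]
        · simp
  refine hnorm.trans ?_
  rw [mul_assoc]
  refine mul_le_mul_of_nonneg_left ?_ hV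
  refine (sum_sum_ite_mul_le S σ (fun p => ‖C p‖) (fun p => w p.1 * w p.2)
    (fun p _ => mul_pos (hw _) (hw _)) K hK).trans_eq ?_
  rw [sq, Finset.sum_mul_sum, Finset.sum_product]
  congr 1
  refine Finset.sum_congr rfl fun n _ => Finset.sum_congr rfl fun m _ => ?_
  simp only [C, norm_mul]; ring

/-- The characters `e^{iπ(px)} e^{2πi q t / P}` of the torus `ℝ/2ℤ × ℝ/Pℤ`. -/
def torusChar (P : ℝ) (g : ℤ × ℤ) (z : ℝ × ℝ) : ℂ :=
  Complex.exp (Complex.I * (2 * Real.pi / 2 * g.1) * z.1) *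
    Complex.exp (Complex.I * (2 * Real.pi / P * g.2) * z.2)

theorem integral_exp_period {P : ℝ} (hP : 0 < P) (q : ℤ) :
    ∫ t in Ioc 0 P, Complex.exp (Complex.I * (2 * Real.pi / P * q) * (t : ℂ)) =
      if q = 0 then (P : ℂ) else 0 := by
  rw [← intervalIntegral.integral_of_le hP.le]
  split_ifs with h
  · simp [h]
  · have hq : (q : ℂ) ≠ 0 := by exact_mod_cast h
    have hP' : (P : ℂ) ≠ 0 := by exact_mod_cast hP.ne'
    have hπ : (Real.pi : ℂ) ≠ 0 := by exact_mod_cast Real.pi_ne_zero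
    rw [integral_exp_mul_complex (mul_ne_zero Complex.I_ne_zero (by simp [hq, hP']))]
    have : Complex.I * (2 * Real.pi / P * q) * (P : ℂ) = q * (2 * Real.pi * Complex.I) := by
      field_simp
    rw [this, Complex.exp_int_mul_two_pi_mul_I]
    simp

/-- Lebesgue measure on the period cell `(0,2] × (0,P]`. -/
def cellMeasure (P : ℝ) : Measure (ℝ × ℝ) :=
  (volume.restrict (Ioc (0 : ℝ) 2)).prod (volume.restrict (Ioc 0 P))

instance (P : ℝ) : IsFiniteMeasure (cellMeasure P) := by
  unfold cellMeasure; infer_instance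

theorem continuous_torusChar (P : ℝ) (g : ℤ × ℤ) : Continuous (torusChar P g) := by
  unfold torusChar; fun_prop

theorem norm_torusChar (P : ℝ) (g : ℤ × ℤ) (z : ℝ × ℝ) : ‖torusChar P g z‖ = 1 := by
  unfold torusChar
  rw [norm_mul, show Complex.I * (2 * Real.pi / 2 * g.1) * (z.1 : ℂ) =
      ((2 * Real.pi / 2 * g.1 * z.1 : ℝ) : ℂ) * Complex.I by push_cast; ring,
    show Complex.I * (2 * Real.pi / P * g.2) * (z.2 : ℂ) =
      ((2 * Real.pi / P * g.2 * z.2 : ℝ) : ℂ) * Complex.I by push_cast; ring,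
    Complex.norm_exp_ofReal_mul_I, Complex.norm_exp_ofReal_mul_I, one_mul]

theorem integrable_torusChar (P : ℝ) (g : ℤ × ℤ) : Integrable (torusChar P g) (cellMeasure P) :=
  Integrable.of_bound (continuous_torusChar P g).aestronglyMeasurable 1
    (.of_forall fun z => (norm_torusChar P g z).le)

theorem integral_torusChar {P : ℝ} (hP : 0 < P) (g : ℤ × ℤ) :
    ∫ z, torusChar P g z ∂(cellMeasure P) = if g = 0 then ((2 * P : ℝ) : ℂ) else 0 := by
  unfold torusChar cellMeasure
  rw [integral_prod_mul (fun x : ℝ => Complex.exp (Complex.I * (2 * Real.pi / 2 * g.1) * (x : ℂ)))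
    (fun t : ℝ => Complex.exp (Complex.I * (2 * Real.pi / P * g.2) * (t : ℂ)))]
  have := integral_exp_period (P := 2) (by norm_num) g.1
  push_cast at this
  rw [this, integral_exp_period hP]
  rcases g with ⟨a, b⟩
  by_cases ha : a = 0 <;> by_cases hb : b = 0 <;> simp [ha, hb]

theorem torusChar_add (P : ℝ) (g h : ℤ × ℤ) (z : ℝ × ℝ) :
    torusChar P (g + h) z = torusChar P g z * torusChar P h z := by
  simp only [torusChar, ← Complex.exp_add]
  congr 1
  simp only [Prod.fst_add, Prod.snd_add]
  push_cast; ring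

theorem torusChar_neg (P : ℝ) (g : ℤ × ℤ) (z : ℝ × ℝ) :
    torusChar P (-g) z = (starRingEnd ℂ) (torusChar P g z) := by
  simp only [torusChar, map_mul, ← Complex.exp_conj]
  simp [map_ofNat]

/-- The `L⁴` bound for lacunary trigonometric sums on the period cell. -/
theorem eLpNorm_sum_torusChar_le {P : ℝ} (hP : 0 < P) (s : Finset ℕ) (γ : ℕ → ℤ × ℤ) (c : ℕ → ℂ)
    (w : ℕ → ℝ) (hw : ∀ n, 0 < w n) {K : ℝ} (hK0 : 0 ≤ K)
    (hK : ∀ g, ∑ p ∈ s ×ˢ s with γ p.1 + γ p.2 = g, (w p.1 * w p.2)⁻¹ ≤ K) :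
    eLpNorm (fun z => ∑ n ∈ s, c n * torusChar P (γ n) z) 4 (cellMeasure P) ≤
      ENNReal.ofReal ((2 * P * K) ^ (1 / 4 : ℝ)) *
        (∑ n ∈ s, ENNReal.ofReal (w n) * ‖c n‖ₑ ^ 2) ^ (1 / 2 : ℝ) := by
  have h := integral_norm_pow_four_le (by positivity : 0 ≤ 2 * P) (torusChar_add P)
    (torusChar_neg P) (integrable_torusChar P) (integral_torusChar hP) s γ c w hw K hK
  have hc : Continuous fun z => ∑ n ∈ s, c n * torusChar P (γ n) z :=
    continuous_finsetSum _ fun n _ => continuous_const.mul (continuous_torusChar P _)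
  have hi : Integrable (fun z => ‖∑ n ∈ s, c n * torusChar P (γ n) z‖ ^ 4) (cellMeasure P) := by
    refine Integrable.of_bound (hc.norm.pow 4).aestronglyMeasurable ((∑ n ∈ s, ‖c n‖) ^ 4)
      (.of_forall fun z => ?_)
    rw [Real.norm_of_nonneg (by positivity)]
    gcongr
    refine (norm_sum_le _ _).trans_eq ?_
    simp [norm_torusChar]
  rw [eLpNorm_eq_lintegral_rpow_enorm_toReal (by norm_num) (by norm_num)]
  have e1 : ∫⁻ z, ‖∑ n ∈ s, c n * torusChar P (γ n) z‖ₑ ^ (4 : ℝ≥0∞).toReal ∂(cellMeasure P) =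
      ENNReal.ofReal (∫ z, ‖∑ n ∈ s, c n * torusChar P (γ n) z‖ ^ 4 ∂(cellMeasure P)) := by
    rw [ofReal_integral_eq_lintegral_ofReal hi (.of_forall fun z => by positivity)]
    refine lintegral_congr fun z => ?_
    rw [ENNReal.ofReal_pow (norm_nonneg _), ofReal_norm]
    norm_num
  have e2 : ∑ n ∈ s, ENNReal.ofReal (w n) * ‖c n‖ₑ ^ 2 =
      ENNReal.ofReal (∑ n ∈ s, w n * ‖c n‖ ^ 2) := by
    rw [ENNReal.ofReal_sum_of_nonneg fun n _ => mul_nonneg (hw n).le (by positivity)]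
    refine Finset.sum_congr rfl fun n _ => ?_
    rw [ENNReal.ofReal_mul (hw n).le, ENNReal.ofReal_pow (norm_nonneg _), ofReal_norm]
  have hnn : 0 ≤ ∑ n ∈ s, w n * ‖c n‖ ^ 2 :=
    Finset.sum_nonneg fun n _ => mul_nonneg (hw n).le (by positivity)
  rw [e1, e2, ENNReal.ofReal_rpow_of_nonneg hnn (by norm_num),
    ← ENNReal.ofReal_mul (by positivity), ENNReal.ofReal_rpow_of_nonneg
      (integral_nonneg fun z => by positivity) (by positivity)]
  refine ENNReal.ofReal_le_ofReal ((Real.rpow_le_rpow (integral_nonneg fun z => by positivity) h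
    (by positivity)).trans_eq ?_)
  rw [Real.mul_rpow (by positivity) (by positivity)]
  norm_num
  left
  rw [← Real.rpow_natCast, ← Real.rpow_mul hnn]
  norm_num

end

/-! ### Sine series: Strichartz and Sobolev estimates. -/

noncomputable section

/-- The mode `sin (nπx) e^{2πi d t / P}`. -/
def sineWave (P : ℝ) (n : ℕ) (d : ℤ) (z : ℝ × ℝ) : ℂ :=
  (Real.sin (n * Real.pi * z.1) : ℂ) * Complex.exp (Complex.I * (2 * Real.pi / P * d) * z.2)

theorem continuous_sineWave (P : ℝ) (n : ℕ) (d : ℤ) : Continuous (sineWave P n d) := by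
  unfold sineWave; fun_prop

theorem sineWave_eq_torusChar (P : ℝ) (n : ℕ) (d : ℤ) (z : ℝ × ℝ) :
    sineWave P n d z = (2 * Complex.I)⁻¹ *
      (torusChar P ((1 : ℤ) * n, d) z - torusChar P ((-1 : ℤ) * n, d) z) := by
  have h : (Real.sin (n * Real.pi * z.1) : ℂ) = (2 * Complex.I)⁻¹ *
      (Complex.exp (n * Real.pi * z.1 * Complex.I) -
        Complex.exp (-(n * Real.pi * z.1) * Complex.I)) := by
    push_cast
    rw [Complex.sin]
    field_simp
    rw [Complex.I_sq]
    ring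
  simp only [sineWave, torusChar, h]
  have e1 : Complex.I * (2 * Real.pi / 2 * ((1 * n : ℤ) : ℂ)) * z.1 =
      n * Real.pi * z.1 * Complex.I := by push_cast; ring
  have e2 : Complex.I * (2 * Real.pi / 2 * ((-1 * n : ℤ) : ℂ)) * z.1 =
      -(n * Real.pi * z.1) * Complex.I := by push_cast; ring
  rw [e1, e2]
  ring

/-- A sine is half, up to a unimodular factor, the difference of the characters with `ε = 1` and `ε
= -1`; each has the same bound, so nothing is lost. -/
theorem eLpNorm_sum_sineWave_le {P : ℝ} (hP : 0 < P) (s : Finset ℕ) (d : ℕ → ℤ) (c : ℕ → ℂ)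
    (w : ℕ → ℝ) (hw : ∀ n, 0 < w n) {K : ℝ} (hK0 : 0 ≤ K)
    (hK : ∀ ε : ℤ, ε ≠ 0 → ∀ g : ℤ × ℤ, ∑ p ∈ s ×ˢ s with
      ((ε * (p.1 : ℤ), d p.1) + (ε * (p.2 : ℤ), d p.2) : ℤ × ℤ) = g, (w p.1 * w p.2)⁻¹ ≤ K) :
    eLpNorm (fun z => ∑ n ∈ s, c n * sineWave P n (d n) z) 4 (cellMeasure P) ≤
      ENNReal.ofReal ((2 * P * K) ^ (1 / 4 : ℝ)) *
        (∑ n ∈ s, ENNReal.ofReal (w n) * ‖c n‖ₑ ^ 2) ^ (1 / 2 : ℝ) := by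
  set R := ENNReal.ofReal ((2 * P * K) ^ (1 / 4 : ℝ)) *
        (∑ n ∈ s, ENNReal.ofReal (w n) * ‖c n‖ₑ ^ 2) ^ (1 / 2 : ℝ)
  have h1 := fun (ε : ℤ) (hε : ε ≠ 0) => eLpNorm_sum_torusChar_le hP s
    (fun n => (ε * (n : ℤ), d n)) c w hw hK0 (hK ε hε)
  have hc : ∀ ε : ℤ, AEStronglyMeasurable
      (fun z => ∑ n ∈ s, c n * torusChar P (ε * (n : ℤ), d n) z) (cellMeasure P) := fun ε =>
    (continuous_finsetSum _ fun n _ =>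
      continuous_const.mul (continuous_torusChar P _)).aestronglyMeasurable
  have e : (fun z => ∑ n ∈ s, c n * sineWave P n (d n) z) = (2 * Complex.I)⁻¹ •
      ((fun z => ∑ n ∈ s, c n * torusChar P ((1 : ℤ) * (n : ℤ), d n) z) -
        fun z => ∑ n ∈ s, c n * torusChar P ((-1 : ℤ) * (n : ℤ), d n) z) := by
    ext z
    simp only [sineWave_eq_torusChar, Pi.smul_apply, Pi.sub_apply, smul_eq_mul,
      ← Finset.sum_sub_distrib, Finset.mul_sum]
    exact Finset.sum_congr rfl fun n _ => by ring
  rw [e, eLpNorm_const_smul]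
  have e2 : ‖(2 * Complex.I)⁻¹‖ₑ = 2⁻¹ := by
    rw [enorm_inv (by simp), enorm_mul, ← ofReal_norm, ← ofReal_norm]
    simp
  calc _ ≤ 2⁻¹ * (R + R) := by
        rw [e2]
        gcongr
        exact (eLpNorm_sub_le (hc 1) (hc (-1)) (by norm_num)).trans
          (add_le_add (h1 1 (by norm_num)) (h1 (-1) (by norm_num)))
    _ = R := by
        rw [← two_mul, ← mul_assoc, ENNReal.inv_mul_cancel (by simp) (by simp), one_mul]

/-- The `L⁴` Strichartz estimate for the periodic Schrödinger equation, in sine series. -/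
theorem eLpNorm_sum_schrodinger_le {P : ℝ} (hP : 0 < P) {M : ℕ} (hM : 1 ≤ M) (s : Finset ℕ)
    (c : ℕ → ℂ) :
    eLpNorm (fun z => ∑ n ∈ s, c n * sineWave P n (-(M * n ^ 2)) z) 4 (cellMeasure P) ≤
      ENNReal.ofReal ((2 * P * 2) ^ (1 / 4 : ℝ)) * (∑ n ∈ s, ‖c n‖ₑ ^ 2) ^ (1 / 2 : ℝ) := by
  have := eLpNorm_sum_sineWave_le hP s (fun n => -((M : ℤ) * n ^ 2)) c (fun _ => 1)
    (fun _ => one_pos) (K := 2) (by norm_num) ?_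
  · simpa using this
  intro ε hε g
  simp only [mul_one, inv_one, Finset.sum_const, nsmul_eq_mul]
  norm_cast
  -- The values `n + m` and `n² + m²` determine the unordered pair `{n, m}`, so a fibre has at most
  -- two points; this is the constant `K = 2`.
  rcases Finset.eq_empty_or_nonempty ((s ×ˢ s).filter fun p : ℕ × ℕ =>
      ((ε * (p.1 : ℤ), -((M : ℤ) * p.1 ^ 2)) + (ε * (p.2 : ℤ), -((M : ℤ) * p.2 ^ 2)) : ℤ × ℤ) = g)
    with h | ⟨⟨a, b⟩, hab⟩
  · push_cast
    rw [h]; simp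
  · refine (Finset.card_le_card (t := {(a, b), (b, a)}) ?_).trans Finset.card_le_two
    rintro ⟨n, m⟩ hnm
    push_cast at hnm
    simp only [Finset.mem_filter] at hab hnm
    have h := hnm.2.trans hab.2.symm
    simp only [Prod.mk_add_mk, Prod.mk.injEq] at h
    obtain ⟨h1, h2⟩ := h
    have h1' : (n : ℤ) + m = a + b := by
      refine mul_left_cancel₀ hε ?_
      linarith
    have hM' : (M : ℤ) ≠ 0 := by positivity
    have h2' : (n : ℤ) ^ 2 + m ^ 2 = a ^ 2 + b ^ 2 := by
      refine mul_left_cancel₀ hM' ?_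
      linarith
    have h3 : ((n : ℤ) - a) * (n - b) = 0 := by
      have : (m : ℤ) = a + b - n := by linarith
      rw [this] at h2'
      linarith
    simp only [Finset.mem_insert, Finset.mem_singleton, Prod.mk.injEq]
    rcases mul_eq_zero.1 h3 with h | h
    · left; omega
    · right; omega

/-- A one-dimensional Sobolev embedding into `L⁴` for sine series. -/
theorem exists_eLpNorm_sum_sine_le {P : ℝ} (hP : 0 < P) : ∃ C : ℝ≥0, ∀ (s : Finset ℕ)
    (c : ℕ → ℂ), eLpNorm (fun z => ∑ n ∈ s, c n * sineWave P n 0 z) 4 (cellMeasure P) ≤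
      C * (∑ n ∈ s, bracket n ^ (3 / 5 : ℝ) * ‖c n‖ₑ ^ 2) ^ (1 / 2 : ℝ) := by
  have hsum : Summable fun n : ℕ => ((n : ℝ) + 1) ^ (-(6 / 5) : ℝ) := by
    have := (summable_nat_add_iff 1).2
      (Real.summable_nat_rpow.2 (show (-(6 / 5) : ℝ) < -1 by norm_num))
    simpa using this
  set K := ∑' n : ℕ, ((n : ℝ) + 1) ^ (-(6 / 5) : ℝ)
  have hK0 : 0 ≤ K := tsum_nonneg fun n => by positivity
  refine ⟨((2 * P * K) ^ (1 / 4 : ℝ)).toNNReal, fun s c => ?_⟩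
  have := eLpNorm_sum_sineWave_le hP s (fun _ => 0) c (fun n => ((n : ℝ) + 1) ^ (3 / 5 : ℝ))
    (fun n => by positivity) hK0 ?_
  · have e : ∀ n : ℕ, bracket n ^ (3 / 5 : ℝ) = ENNReal.ofReal (((n : ℝ) + 1) ^ (3 / 5 : ℝ)) := by
      intro n
      rw [← ENNReal.ofReal_rpow_of_pos (by positivity), bracket, ← ENNReal.ofReal_natCast]
      simp
    simp only [e]
    exact this
  intro ε hε g
  set S := (s ×ˢ s).filter fun p : ℕ × ℕ =>
      ((ε * (p.1 : ℤ), 0) + (ε * (p.2 : ℤ), 0) : ℤ × ℤ) = g with hS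
  -- On a fibre the sum of the coordinates is fixed, so each coordinate is injective there.
  have hinj : ∀ p ∈ S, ∀ q ∈ S, p.1 + p.2 = q.1 + q.2 := by
    intro p hp q hq
    simp only [hS, Finset.mem_filter] at hp hq
    have h := hp.2.trans hq.2.symm
    simp only [Prod.mk_add_mk, Prod.mk.injEq] at h
    have : (p.1 : ℤ) + p.2 = q.1 + q.2 := mul_left_cancel₀ hε (by linarith [h.1])
    exact_mod_cast this
  have hbound : ∀ f : ℕ × ℕ → ℕ, Set.InjOn f S →
      ∑ p ∈ S, ((f p : ℝ) + 1) ^ (-(6 / 5) : ℝ) ≤ K := by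
    intro f hf
    rw [← Finset.sum_image (f := fun n : ℕ => ((n : ℝ) + 1) ^ (-(6 / 5) : ℝ)) hf]
    exact hsum.sum_le_tsum _ fun n _ => by positivity
  -- AM–GM decouples the coordinates and doubles the exponent to `6/5 > 1`, which is summable.
  have h1 : ∀ p : ℕ × ℕ, (((p.1 : ℝ) + 1) ^ (3 / 5 : ℝ) * ((p.2 : ℝ) + 1) ^ (3 / 5 : ℝ))⁻¹ ≤
      2⁻¹ * ((p.1 : ℝ) + 1) ^ (-(6 / 5) : ℝ) + 2⁻¹ * ((p.2 : ℝ) + 1) ^ (-(6 / 5) : ℝ) := by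
    intro p
    have e : ∀ n : ℕ, ((n : ℝ) + 1) ^ (-(6 / 5) : ℝ) = ((((n : ℝ) + 1) ^ (3 / 5 : ℝ))⁻¹) ^ 2 := by
      intro n
      rw [← Real.rpow_neg (by positivity), ← Real.rpow_natCast, ← Real.rpow_mul (by positivity)]
      norm_num
    rw [e, e, mul_inv]
    nlinarith [sq_nonneg ((((p.1 : ℝ) + 1) ^ (3 / 5 : ℝ))⁻¹ - (((p.2 : ℝ) + 1) ^ (3 / 5 : ℝ))⁻¹)]
  calc ∑ p ∈ S, (((p.1 : ℝ) + 1) ^ (3 / 5 : ℝ) * ((p.2 : ℝ) + 1) ^ (3 / 5 : ℝ))⁻¹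
      ≤ ∑ p ∈ S, (2⁻¹ * ((p.1 : ℝ) + 1) ^ (-(6 / 5) : ℝ) +
          2⁻¹ * ((p.2 : ℝ) + 1) ^ (-(6 / 5) : ℝ)) := Finset.sum_le_sum fun p _ => h1 p
    _ ≤ 2⁻¹ * K + 2⁻¹ * K := by
        rw [Finset.sum_add_distrib, ← Finset.mul_sum, ← Finset.mul_sum]
        gcongr
        · refine hbound Prod.fst fun p hp q hq h => ?_
          have := hinj p hp q hq
          ext <;> omega
        · refine hbound Prod.snd fun p hp q hq h => ?_
          have := hinj p hp q hq
          ext <;> omega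
    _ = K := by ring

theorem restrict_le_cellMeasure {T P : ℝ} (hTP : T ≤ P) :
    (volume : Measure (ℝ × ℝ)).restrict (Ioo (0 : ℝ) 1 ×ˢ Ioo 0 T) ≤ cellMeasure P := by
  rw [cellMeasure, Measure.prod_restrict, ← Measure.volume_eq_prod]
  refine Measure.restrict_mono (prod_mono ?_ ?_) le_rfl
  · exact fun x hx => ⟨hx.1, by linarith [hx.2]⟩
  · exact fun x hx => ⟨hx.1, hx.2.le.trans hTP⟩

end

/-! ### Coefficient bounds in the near and far regimes. -/

noncomputable section

/-- The coefficients `P n a_k / (M n² + k)`, set to `0` at the resonance `k = -M n²`. -/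
def duhamelCoeff (P : ℝ) (M : ℕ) (a : ℤ → ℂ) (n : ℕ) (k : ℤ) : ℂ :=
  if k + M * n ^ 2 = 0 then 0 else P * n * a k / ((k + M * n ^ 2 : ℤ) : ℂ)

/-- The part of `duhamelCoeff` with `M n² ≤ 2 |k|`. -/
def nearCoeff (P : ℝ) (M : ℕ) (a : ℤ → ℂ) (n : ℕ) (k : ℤ) : ℂ :=
  if M * n ^ 2 ≤ 2 * k.natAbs then duhamelCoeff P M a n k else 0

/-- The part of `duhamelCoeff` with `2 |k| < M n²`. -/
def farCoeff (P : ℝ) (M : ℕ) (a : ℤ → ℂ) (n : ℕ) (k : ℤ) : ℂ :=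
  if M * n ^ 2 ≤ 2 * k.natAbs then 0 else duhamelCoeff P M a n k

theorem nearCoeff_add_farCoeff (P : ℝ) (M : ℕ) (a : ℤ → ℂ) (n : ℕ) (k : ℤ) :
    nearCoeff P M a n k + farCoeff P M a n k = duhamelCoeff P M a n k := by
  unfold nearCoeff farCoeff; split_ifs <;> simp

/-- The squared norm `∑ (1 + |k|) |a_k|²`. -/
def halfEnergy (a : ℤ → ℂ) : ℝ≥0∞ := ∑' k, bracket k * ‖a k‖ₑ ^ 2

variable {P : ℝ} {M : ℕ}

theorem bracket_eq_ofReal (k : ℤ) : bracket k = ENNReal.ofReal ((k.natAbs : ℝ) + 1) := by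
  rw [bracket, ← ENNReal.ofReal_natCast]
  push_cast
  rfl

/-- Here `n² ≤ 2|k|`, so the weight of `a_k` absorbs `n²`; off resonance `1 + |l| ≤ 2|l|` for `l = k
+ M n²`. Together these give `8 = 2 · 4`. -/
theorem enorm_nearCoeff_sq_le (hP : 0 < P) (hM : 1 ≤ M) (a : ℤ → ℂ) (n : ℕ) (k : ℤ) :
    ‖nearCoeff P M a n k‖ₑ ^ 2 ≤ ENNReal.ofReal (8 * P ^ 2) * (bracket k * ‖a k‖ₑ ^ 2) *
      bracket (k + M * n ^ 2) ^ (-2 : ℝ) := by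
  unfold nearCoeff duhamelCoeff
  split_ifs with h1 h2
  · simp
  · set l : ℤ := k + M * n ^ 2
    have hl : 1 ≤ (l.natAbs : ℝ) := by
      exact_mod_cast Nat.one_le_iff_ne_zero.2 (Int.natAbs_ne_zero.2 h2)
    have hn : (n : ℝ) ^ 2 ≤ 2 * ((k.natAbs : ℝ) + 1) := by
      have h3 : n ^ 2 ≤ M * n ^ 2 := Nat.le_mul_of_pos_left _ hM
      have : (n : ℝ) ^ 2 ≤ 2 * (k.natAbs : ℝ) := by exact_mod_cast h3.trans h1
      linarith
    rw [bracket_eq_ofReal, bracket_eq_ofReal, ENNReal.ofReal_rpow_of_pos (by positivity),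
      ← ofReal_norm, ← ofReal_norm, ← ENNReal.ofReal_pow (norm_nonneg _),
      ← ENNReal.ofReal_pow (norm_nonneg _), ← ENNReal.ofReal_mul (by positivity),
      ← ENNReal.ofReal_mul (by positivity), ← ENNReal.ofReal_mul (by positivity)]
    refine ENNReal.ofReal_le_ofReal ?_
    have e : ‖((l : ℤ) : ℂ)‖ = (l.natAbs : ℝ) := by
      rw [Complex.norm_intCast, Nat.cast_natAbs, Int.cast_abs]
    rw [norm_div, norm_mul, norm_mul, e, Complex.norm_real, Complex.norm_natCast,
      Real.norm_of_nonneg hP.le, Real.rpow_neg (by positivity)]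
    norm_num only [Real.rpow_ofNat]
    rw [div_pow, ← div_eq_mul_inv, div_le_div_iff₀ (by positivity) (by positivity)]
    have hl2 : ((l.natAbs : ℝ) + 1) ^ 2 ≤ 4 * (l.natAbs : ℝ) ^ 2 := by nlinarith
    calc (P * n * ‖a k‖) ^ 2 * ((l.natAbs : ℝ) + 1) ^ 2 =
        P ^ 2 * ‖a k‖ ^ 2 * ((n : ℝ) ^ 2 * ((l.natAbs : ℝ) + 1) ^ 2) := by ring
      _ ≤ P ^ 2 * ‖a k‖ ^ 2 * ((2 * ((k.natAbs : ℝ) + 1)) * (4 * (l.natAbs : ℝ) ^ 2)) := by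
        gcongr
      _ = _ := by ring
  · simp

/-- The denominator is at least `M n²/2`, giving decay of order `1/n`. Since `1 + |k| ≤ M(1 + n)²`,
a factor `⟨n⟩^{-1/8}` is traded for `⟨k⟩^{-1/16}`, just enough to sum over `k` later. -/
theorem enorm_farCoeff_le (hP : 0 < P) (hM : 1 ≤ M) (a : ℤ → ℂ) (n : ℕ) (k : ℤ) :
    ‖farCoeff P M a n k‖ₑ ≤ ENNReal.ofReal (4 * P) * M ^ (1 / 16 : ℝ) *
      bracket n ^ (-(7 / 8) : ℝ) * (bracket k ^ (-(1 / 16) : ℝ) * ‖a k‖ₑ) := by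
  unfold farCoeff duhamelCoeff
  split_ifs with h1 h2
  · simp
  · simp
  · have hx0 := bracket_ne_zero n
    have hxt := bracket_ne_top n
    have hy0 := bracket_ne_zero k
    have hyt := bracket_ne_top k
    have hk : 2 * k.natAbs < M * n ^ 2 := not_le.1 h1
    have hn : 1 ≤ n := by
      rcases Nat.eq_zero_or_pos n with h | h
      · simp [h] at hk
      · exact h
    have hbase : ‖P * n * a k / ((k + M * n ^ 2 : ℤ) : ℂ)‖ₑ ≤
        ENNReal.ofReal (4 * P) * bracket n ^ (-1 : ℝ) * ‖a k‖ₑ := by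
      rw [bracket_eq_ofReal, ENNReal.ofReal_rpow_of_pos (by positivity),
        ← ofReal_norm, ← ofReal_norm, ← ENNReal.ofReal_mul (by positivity),
        ← ENNReal.ofReal_mul (by positivity)]
      refine ENNReal.ofReal_le_ofReal ?_
      set l : ℤ := k + M * n ^ 2
      have e : ‖((l : ℤ) : ℂ)‖ = (l.natAbs : ℝ) := by
        rw [Complex.norm_intCast, Nat.cast_natAbs, Int.cast_abs]
      have hl : (n : ℝ) ^ 2 ≤ 2 * (l.natAbs : ℝ) := by
        have h3 : n ^ 2 ≤ M * n ^ 2 := Nat.le_mul_of_pos_left _ hM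
        have h4 : M * n ^ 2 ≤ 2 * l.natAbs := by
          zify at hk ⊢
          have h5 : (l : ℤ) ≤ |l| := le_abs_self _
          have h6 := neg_abs_le k
          have h7 : l = k + M * n ^ 2 := rfl
          linarith
        exact_mod_cast h3.trans h4
      have hn' : (1 : ℝ) ≤ n := by exact_mod_cast hn
      rw [norm_div, norm_mul, norm_mul, e, Complex.norm_real, Complex.norm_natCast,
        Real.norm_of_nonneg hP.le, Real.rpow_neg_one, Int.natAbs_natCast]
      have hl0 : 0 < (l.natAbs : ℝ) := by nlinarith
      rw [div_le_iff₀ hl0]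
      have : (n : ℝ) ≤ 4 * ((n : ℝ) + 1)⁻¹ * l.natAbs := by
        rw [mul_assoc, mul_comm _ (l.natAbs : ℝ), ← mul_assoc, ← div_eq_mul_inv,
          le_div_iff₀ (by positivity)]
        nlinarith
      calc P * n * ‖a k‖ ≤ P * (4 * ((n : ℝ) + 1)⁻¹ * l.natAbs) * ‖a k‖ := by gcongr
        _ = _ := by ring
    have hxy : bracket k ^ (1 / 16 : ℝ) ≤ M ^ (1 / 16 : ℝ) * bracket n ^ (1 / 8 : ℝ) := by
      have h3 : bracket k ≤ M * bracket n ^ (2 : ℝ) := by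
        rw [ENNReal.rpow_ofNat, bracket, bracket]
        have : k.natAbs + 1 ≤ M * ((n : ℤ).natAbs + 1) ^ 2 := by
          rw [Int.natAbs_natCast]
          nlinarith
        exact_mod_cast this
      have := ENNReal.rpow_le_rpow h3 (show (0 : ℝ) ≤ 1 / 16 by norm_num)
      rw [ENNReal.mul_rpow_of_nonneg _ _ (by norm_num), ← ENNReal.rpow_mul] at this
      convert this using 3; norm_num
    have hxy' : bracket n ^ (-(1 / 8) : ℝ) ≤ M ^ (1 / 16 : ℝ) * bracket k ^ (-(1 / 16) : ℝ) := by
      rw [ENNReal.rpow_neg, ENNReal.rpow_neg, ← div_eq_mul_inv, ENNReal.le_div_iff_mul_le,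
        mul_comm, ← div_eq_mul_inv]
      · exact ENNReal.div_le_of_le_mul hxy
      · left
        exact (ENNReal.rpow_pos (by simpa [pos_iff_ne_zero] using hy0) hyt).ne'
      · left
        exact ENNReal.rpow_ne_top_of_nonneg (by norm_num) hyt
    calc _ ≤ _ := hbase
      _ = ENNReal.ofReal (4 * P) * (bracket n ^ (-(7 / 8) : ℝ) * bracket n ^ (-(1 / 8) : ℝ)) *
          ‖a k‖ₑ := by rw [bracket_rpow_add]; norm_num
      _ ≤ ENNReal.ofReal (4 * P) * (bracket n ^ (-(7 / 8) : ℝ) *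
          (M ^ (1 / 16 : ℝ) * bracket k ^ (-(1 / 16) : ℝ))) * ‖a k‖ₑ := by gcongr
      _ = _ := by ring

theorem ENNReal.le_rpow_half_of_sq_le {x y : ℝ≥0∞} (h : x ^ 2 ≤ y) : x ≤ y ^ (1 / 2 : ℝ) := by
  have := ENNReal.rpow_le_rpow h (show (0 : ℝ) ≤ 1 / 2 by norm_num)
  rwa [← ENNReal.rpow_natCast, ← ENNReal.rpow_mul, show ((2 : ℕ) : ℝ) * (1 / 2) = 1 by norm_num,
    ENNReal.rpow_one] at this

theorem ENNReal.rpow_half_sq (x : ℝ≥0∞) : (x ^ (1 / 2 : ℝ)) ^ 2 = x := by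
  rw [← ENNReal.rpow_natCast, ← ENNReal.rpow_mul]
  norm_num

theorem ENNReal.sq_rpow_half (x : ℝ≥0∞) : (x ^ 2) ^ (1 / 2 : ℝ) = x := by
  rw [← ENNReal.rpow_natCast, ← ENNReal.rpow_mul]
  norm_num

/-- The exponent `5/4` exceeds 1, as needed for Cauchy–Schwarz over `k + M n²`, yet leaves `5/4 - 2
= -3/4`, whose sum over `n` is bounded uniformly in `k` by quadratic sparsity. -/
theorem exists_tsum_weight_nearCoeff_le (hP : 0 < P) (hM : 1 ≤ M) : ∃ C : ℝ≥0, ∀ a : ℤ → ℂ,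
    ∑' (n : ℕ) (k : ℤ), bracket (k + M * n ^ 2) ^ (5 / 4 : ℝ) * ‖nearCoeff P M a n k‖ₑ ^ 2 ≤
      C * halfEnergy a := by
  obtain ⟨C, hC⟩ := exists_tsum_bracket_quadratic_le
  refine ⟨(8 * P ^ 2).toNNReal * C, fun a => ?_⟩
  calc _ ≤ ∑' (n : ℕ) (k : ℤ), ENNReal.ofReal (8 * P ^ 2) * (bracket k * ‖a k‖ₑ ^ 2) *
        bracket (k + M * n ^ 2) ^ (-(3 / 4) : ℝ) := by
        refine ENNReal.tsum_le_tsum fun n => ENNReal.tsum_le_tsum fun k => ?_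
        refine (mul_le_mul_right (enorm_nearCoeff_sq_le hP hM a n k) _).trans_eq ?_
        rw [mul_left_comm, bracket_rpow_add]
        norm_num
    _ = ∑' k : ℤ, ENNReal.ofReal (8 * P ^ 2) * (bracket k * ‖a k‖ₑ ^ 2) *
        ∑' n : ℕ, bracket (k + M * n ^ 2) ^ (-(3 / 4) : ℝ) := by
        rw [ENNReal.tsum_comm]
        simp only [ENNReal.tsum_mul_left]
    _ ≤ ∑' k : ℤ, ENNReal.ofReal (8 * P ^ 2) * (bracket k * ‖a k‖ₑ ^ 2) * C := by
        gcongr with k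
        exact hC M hM k
    _ = _ := by
        rw [ENNReal.tsum_mul_right, ENNReal.tsum_mul_left, halfEnergy, ENNReal.coe_mul,
          ENNReal.ofReal]
        ring

/-- Cauchy–Schwarz with `-1/16 = -9/16 + 1/2`. Without the gain of `1/16` the sum of `⟨k⟩^{-1}`
would diverge. -/
theorem exists_tsum_far_weight_le : ∃ C : ℝ≥0, ∀ a : ℤ → ℂ,
    ∑' k : ℤ, bracket k ^ (-(1 / 16) : ℝ) * ‖a k‖ₑ ≤ C * halfEnergy a ^ (1 / 2 : ℝ) := by
  have hS : ∑' k : ℤ, bracket k ^ (-(9 / 8) : ℝ) ≠ ∞ := tsum_bracket_rpow_ne_top (by norm_num)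
  refine ⟨((∑' k : ℤ, bracket k ^ (-(9 / 8) : ℝ)) ^ (1 / 2 : ℝ)).toNNReal, fun a => ?_⟩
  rw [ENNReal.coe_toNNReal (by finiteness), ← ENNReal.mul_rpow_of_nonneg _ _ (by norm_num)]
  refine ENNReal.le_rpow_half_of_sq_le ?_
  have := ENNReal.tsum_mul_sq_le (fun k : ℤ => bracket k ^ (-(9 / 16) : ℝ))
    (fun k => bracket k ^ (1 / 2 : ℝ) * ‖a k‖ₑ)
  convert this using 2
  · congr 1; ext k
    rw [← mul_assoc, bracket_rpow_add]; norm_num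
  · congr 1; ext k
    rw [← ENNReal.rpow_natCast, ← ENNReal.rpow_mul]; norm_num
  · unfold halfEnergy
    congr 1; ext k
    rw [mul_pow, ENNReal.rpow_half_sq]

/-- For fixed `l = k + M n²` the inner sum is the squared `ℓ²` size of the data of one free
solution. The weight `⟨l⟩^{5/4}` makes the square roots summable in `l`. -/
theorem exists_tsum_rpow_nearCoeff_le (hP : 0 < P) (hM : 1 ≤ M) : ∃ C : ℝ≥0, ∀ a : ℤ → ℂ,
    ∑' l : ℤ, (∑' n : ℕ, ‖nearCoeff P M a n (l - M * n ^ 2)‖ₑ ^ 2) ^ (1 / 2 : ℝ) ≤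
      C * halfEnergy a ^ (1 / 2 : ℝ) := by
  obtain ⟨C, hC⟩ := exists_tsum_weight_nearCoeff_le hP hM
  have hS : ∑' k : ℤ, bracket k ^ (-(5 / 4) : ℝ) ≠ ∞ := tsum_bracket_rpow_ne_top (by norm_num)
  set S := ∑' k : ℤ, bracket k ^ (-(5 / 4) : ℝ)
  refine ⟨((S * C) ^ (1 / 2 : ℝ)).toNNReal, fun a => ?_⟩
  rw [ENNReal.coe_toNNReal (by finiteness), ← ENNReal.mul_rpow_of_nonneg _ _ (by norm_num)]
  refine ENNReal.le_rpow_half_of_sq_le ?_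
  set X : ℤ → ℝ≥0∞ := fun l => ∑' n : ℕ, ‖nearCoeff P M a n (l - M * n ^ 2)‖ₑ ^ 2
  have h := ENNReal.tsum_mul_sq_le (fun l : ℤ => bracket l ^ (-(5 / 8) : ℝ))
    (fun l => (bracket l ^ (5 / 4 : ℝ) * X l) ^ (1 / 2 : ℝ))
  have e1 : ∀ l : ℤ, bracket l ^ (-(5 / 8) : ℝ) * (bracket l ^ (5 / 4 : ℝ) * X l) ^ (1 / 2 : ℝ) =
      X l ^ (1 / 2 : ℝ) := by
    intro l
    rw [ENNReal.mul_rpow_of_nonneg _ _ (by norm_num), ← ENNReal.rpow_mul, ← mul_assoc,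
      bracket_rpow_add]
    norm_num
  have e2 : ∀ l : ℤ, (bracket l ^ (-(5 / 8) : ℝ)) ^ 2 = bracket l ^ (-(5 / 4) : ℝ) := by
    intro l
    rw [← ENNReal.rpow_natCast, ← ENNReal.rpow_mul]; norm_num
  simp only [e1, e2, ENNReal.rpow_half_sq] at h
  refine h.trans ?_
  rw [mul_assoc]
  gcongr
  refine le_trans (le_of_eq ?_) (hC a)
  simp only [X, ← ENNReal.tsum_mul_left]
  rw [ENNReal.tsum_comm]
  refine tsum_congr fun n => ?_
  rw [← (Equiv.addRight ((M : ℤ) * (n : ℤ) ^ 2)).tsum_eq]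
  simp

/-- Absolute summability in `k` makes the bound insensitive to the time phases. The near part uses
Cauchy–Schwarz with the weight `⟨k + M n²⟩^{5/4}`; the far part factorises, with `⟨n⟩^{-7/4}`
summable. -/
theorem exists_tsum_tsum_duhamelCoeff_sq_le (hP : 0 < P) (hM : 1 ≤ M) :
    ∃ C : ℝ≥0, ∀ a : ℤ → ℂ,
      ∑' n : ℕ, (∑' k : ℤ, ‖duhamelCoeff P M a n k‖ₑ) ^ 2 ≤ C * halfEnergy a := by
  obtain ⟨C₁, hC₁⟩ := exists_tsum_weight_nearCoeff_le hP hM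
  obtain ⟨C₂, hC₂⟩ := exists_tsum_far_weight_le
  have hS : ∑' k : ℤ, bracket k ^ (-(5 / 4) : ℝ) ≠ ∞ := tsum_bracket_rpow_ne_top (by norm_num)
  set S := ∑' k : ℤ, bracket k ^ (-(5 / 4) : ℝ)
  have hS' : ∑' k : ℤ, bracket k ^ (-(7 / 4) : ℝ) ≠ ∞ := tsum_bracket_rpow_ne_top (by norm_num)
  set S' := ∑' k : ℤ, bracket k ^ (-(7 / 4) : ℝ)
  set A : ℝ≥0∞ := ENNReal.ofReal (4 * P) * M ^ (1 / 16 : ℝ)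
  have hAt : A ≠ ∞ := ENNReal.mul_ne_top ENNReal.ofReal_ne_top
    (ENNReal.rpow_ne_top_of_nonneg (by norm_num) (by simp))
  have hfarA : ∀ (a : ℤ → ℂ) (n : ℕ) (k : ℤ), ‖farCoeff P M a n k‖ₑ ≤
      A * bracket n ^ (-(7 / 8) : ℝ) * (bracket k ^ (-(1 / 16) : ℝ) * ‖a k‖ₑ) :=
    enorm_farCoeff_le hP hM
  clear_value A
  refine ⟨(2 * (S * C₁) + 2 * (A ^ 2 * S' * C₂ ^ 2)).toNNReal, fun a => ?_⟩
  rw [ENNReal.coe_toNNReal (by finiteness)]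
  have hnear : ∀ n : ℕ, (∑' k : ℤ, ‖nearCoeff P M a n k‖ₑ) ^ 2 ≤
      S * ∑' k : ℤ, bracket (k + M * n ^ 2) ^ (5 / 4 : ℝ) * ‖nearCoeff P M a n k‖ₑ ^ 2 := by
    intro n
    have h := ENNReal.tsum_mul_sq_le (fun k : ℤ => bracket (k + M * n ^ 2) ^ (-(5 / 8) : ℝ))
      (fun k => bracket (k + M * n ^ 2) ^ (5 / 8 : ℝ) * ‖nearCoeff P M a n k‖ₑ)
    have e1 : ∀ k : ℤ, bracket (k + M * n ^ 2) ^ (-(5 / 8) : ℝ) *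
        (bracket (k + M * n ^ 2) ^ (5 / 8 : ℝ) * ‖nearCoeff P M a n k‖ₑ) =
        ‖nearCoeff P M a n k‖ₑ := by
      intro k
      rw [← mul_assoc, bracket_rpow_add]; norm_num
    have e2 : ∀ l : ℤ, ∀ x : ℝ, (bracket l ^ x) ^ 2 = bracket l ^ (2 * x) := by
      intro l x
      rw [← ENNReal.rpow_natCast, ← ENNReal.rpow_mul, mul_comm]; norm_num
    simp only [e1, mul_pow, e2] at h
    norm_num only at h
    refine h.trans (mul_le_mul_left (le_of_eq ?_) _)
    exact (Equiv.addRight ((M : ℤ) * (n : ℤ) ^ 2)).tsum_eq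
      (fun k : ℤ => bracket k ^ (-(5 / 4) : ℝ))
  have hfar : ∀ n : ℕ, (∑' k : ℤ, ‖farCoeff P M a n k‖ₑ) ^ 2 ≤
      A ^ 2 * bracket n ^ (-(7 / 4) : ℝ) * (C₂ ^ 2 * halfEnergy a) := by
    intro n
    calc (∑' k : ℤ, ‖farCoeff P M a n k‖ₑ) ^ 2
        ≤ (A * bracket n ^ (-(7 / 8) : ℝ) * (C₂ * halfEnergy a ^ (1 / 2 : ℝ))) ^ 2 := by
          gcongr
          refine (ENNReal.tsum_le_tsum fun k => hfarA a n k).trans ?_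
          rw [ENNReal.tsum_mul_left]
          exact mul_le_mul_right (hC₂ a) _
      _ = _ := by
          rw [mul_pow, mul_pow, mul_pow, ENNReal.rpow_half_sq, ← ENNReal.rpow_natCast
            (bracket n ^ (-(7 / 8) : ℝ)), ← ENNReal.rpow_mul]
          norm_num
  have hsq : ∀ x y : ℝ≥0∞, (x + y) ^ 2 ≤ 2 * x ^ 2 + 2 * y ^ 2 := by
    intro x y
    rw [← mul_add]
    have h := ENNReal.tsum_mul_sq_le (fun _ : Bool => 1) (fun b => if b then x else y)
    simp only [tsum_fintype, Fintype.sum_bool] at h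
    simpa [one_add_one_eq_two] using h
  calc _ ≤ ∑' n : ℕ, (2 * (∑' k : ℤ, ‖nearCoeff P M a n k‖ₑ) ^ 2 +
          2 * (∑' k : ℤ, ‖farCoeff P M a n k‖ₑ) ^ 2) := by
        refine ENNReal.tsum_le_tsum fun n => le_trans ?_ (hsq _ _)
        rw [← ENNReal.tsum_add]
        gcongr with k
        rw [← nearCoeff_add_farCoeff]
        exact enorm_add_le _ _
    _ ≤ ∑' n : ℕ, (2 * (S * ∑' k : ℤ, bracket (k + M * n ^ 2) ^ (5 / 4 : ℝ) *
          ‖nearCoeff P M a n k‖ₑ ^ 2) +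
          2 * (A ^ 2 * bracket n ^ (-(7 / 4) : ℝ) * (C₂ ^ 2 * halfEnergy a))) := by
        gcongr with n
        · exact hnear n
        · exact hfar n
    _ ≤ 2 * (S * (C₁ * halfEnergy a)) + 2 * (A ^ 2 * S' * (C₂ ^ 2 * halfEnergy a)) := by
        rw [ENNReal.tsum_add, ENNReal.tsum_mul_left, ENNReal.tsum_mul_left,
          ENNReal.tsum_mul_left, ENNReal.tsum_mul_right, ENNReal.tsum_mul_left]
        gcongr
        · exact hC₁ a
        · exact ENNReal.tsum_comp_le_tsum_of_injective (f := fun n : ℕ => (n : ℤ))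
            Nat.cast_injective fun k : ℤ => bracket k ^ (-(7 / 4) : ℝ)
    _ = _ := by ring

/-- The far decay leaves room for the Sobolev weight: `3/5 - 7/4 = -23/20 < -1`. -/
theorem exists_tsum_rpow_farCoeff_le (hP : 0 < P) (hM : 1 ≤ M) : ∃ C : ℝ≥0, ∀ a : ℤ → ℂ,
    ∑' k : ℤ, (∑' n : ℕ, bracket n ^ (3 / 5 : ℝ) * ‖farCoeff P M a n k‖ₑ ^ 2) ^ (1 / 2 : ℝ) ≤
      C * halfEnergy a ^ (1 / 2 : ℝ) := by
  obtain ⟨C₂, hC₂⟩ := exists_tsum_far_weight_le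
  have hS : ∑' k : ℤ, bracket k ^ (-(23 / 20) : ℝ) ≠ ∞ := tsum_bracket_rpow_ne_top (by norm_num)
  set S := ∑' k : ℤ, bracket k ^ (-(23 / 20) : ℝ)
  set A : ℝ≥0∞ := ENNReal.ofReal (4 * P) * M ^ (1 / 16 : ℝ)
  have hAt : A ≠ ∞ := ENNReal.mul_ne_top ENNReal.ofReal_ne_top
    (ENNReal.rpow_ne_top_of_nonneg (by norm_num) (by simp))
  have hfarA : ∀ (a : ℤ → ℂ) (n : ℕ) (k : ℤ), ‖farCoeff P M a n k‖ₑ ≤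
      A * bracket n ^ (-(7 / 8) : ℝ) * (bracket k ^ (-(1 / 16) : ℝ) * ‖a k‖ₑ) :=
    enorm_farCoeff_le hP hM
  clear_value A
  refine ⟨(S ^ (1 / 2 : ℝ) * A * C₂).toNNReal, fun a => ?_⟩
  rw [ENNReal.coe_toNNReal (by finiteness)]
  have h : ∀ k : ℤ, (∑' n : ℕ, bracket n ^ (3 / 5 : ℝ) * ‖farCoeff P M a n k‖ₑ ^ 2) ^
      (1 / 2 : ℝ) ≤ S ^ (1 / 2 : ℝ) * A * (bracket k ^ (-(1 / 16) : ℝ) * ‖a k‖ₑ) := by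
    intro k
    calc _ ≤ (∑' n : ℕ, bracket n ^ (-(23 / 20) : ℝ) *
          (A * (bracket k ^ (-(1 / 16) : ℝ) * ‖a k‖ₑ)) ^ 2) ^ (1 / 2 : ℝ) := by
          refine ENNReal.rpow_le_rpow (ENNReal.tsum_le_tsum fun n => ?_) (by norm_num)
          calc bracket n ^ (3 / 5 : ℝ) * ‖farCoeff P M a n k‖ₑ ^ 2 ≤ bracket n ^ (3 / 5 : ℝ) *
              (A * bracket n ^ (-(7 / 8) : ℝ) * (bracket k ^ (-(1 / 16) : ℝ) * ‖a k‖ₑ)) ^ 2 := by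
                gcongr
                exact hfarA a n k
            _ = (bracket n ^ (3 / 5 : ℝ) * bracket n ^ (-(7 / 4) : ℝ)) *
                (A * (bracket k ^ (-(1 / 16) : ℝ) * ‖a k‖ₑ)) ^ 2 := by
                have : bracket n ^ (-(7 / 4) : ℝ) = (bracket n ^ (-(7 / 8) : ℝ)) ^ 2 := by
                  rw [← ENNReal.rpow_natCast (bracket n ^ (-(7 / 8) : ℝ)), ← ENNReal.rpow_mul]
                  norm_num
                rw [this]; ring
            _ = _ := by rw [bracket_rpow_add]; norm_num
      _ ≤ (S * (A * (bracket k ^ (-(1 / 16) : ℝ) * ‖a k‖ₑ)) ^ 2) ^ (1 / 2 : ℝ) := by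
          rw [ENNReal.tsum_mul_right]
          gcongr
          exact ENNReal.tsum_comp_le_tsum_of_injective (f := fun n : ℕ => (n : ℤ))
            Nat.cast_injective fun k : ℤ => bracket k ^ (-(23 / 20) : ℝ)
      _ = _ := by
          rw [ENNReal.mul_rpow_of_nonneg _ _ (by norm_num), ENNReal.sq_rpow_half]
          ring
  refine (ENNReal.tsum_le_tsum h).trans ?_
  rw [ENNReal.tsum_mul_left, mul_assoc _ (C₂ : ℝ≥0∞)]
  gcongr
  exact hC₂ a

/-- At `k = -M n²` the weight of `a_k` dominates `n²`, and distinct `n` give distinct `k`. -/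
theorem tsum_resonant_le (hM : 1 ≤ M) (a : ℤ → ℂ) :
    ∑' n : ℕ, ‖(n : ℂ) * a (-(M * n ^ 2))‖ₑ ^ 2 ≤ halfEnergy a := by
  have hinj : Function.Injective fun n : ℕ => -((M : ℤ) * (n : ℤ) ^ 2) := by
    intro n m h
    have hM' : (M : ℤ) ≠ 0 := by positivity
    have h' : (n : ℤ) ^ 2 = m ^ 2 := mul_left_cancel₀ hM' (neg_injective h)
    exact_mod_cast (pow_left_inj₀ (by positivity) (by positivity) two_ne_zero).1 h'
  refine le_trans (ENNReal.tsum_le_tsum fun n => ?_)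
    (ENNReal.tsum_comp_le_tsum_of_injective hinj fun k => bracket k * ‖a k‖ₑ ^ 2)
  rw [enorm_mul, mul_pow]
  gcongr
  rw [← ofReal_norm, Complex.norm_natCast, ENNReal.ofReal_natCast, bracket]
  have h3 : n ^ 2 ≤ M * n ^ 2 := Nat.le_mul_of_pos_left _ hM
  have h4 : (-((M : ℤ) * (n : ℤ) ^ 2)).natAbs = M * n ^ 2 := by
    rw [Int.natAbs_neg]; norm_cast
  rw [h4]
  exact_mod_cast h3.trans (Nat.le_succ _)

end

/-! ### Bounds for the sine coefficients and for the `L⁴` norm. -/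

noncomputable section

/-- Fatou along an exhausting sequence of finite partial sums, each bounded by the triangle
inequality. -/
theorem eLpNorm_tsum_le {α ι : Type*} [Countable ι] {m : MeasurableSpace α} {μ : Measure α}
    {p : ℝ≥0∞} (hp : 1 ≤ p) {f : ι → α → ℂ} (hf : ∀ i, AEStronglyMeasurable (f i) μ)
    (hs : ∀ x, Summable fun i => f i x) :
    eLpNorm (fun x => ∑' i, f i x) p μ ≤ ∑' i, eLpNorm (f i) p μ := by
  obtain ⟨u, hu⟩ := Filter.exists_seq_tendsto (Filter.atTop : Filter (Finset ι))
  refine (Lp.eLpNorm_lim_le_liminf_eLpNorm (f := fun N x => ∑ i ∈ u N, f i x)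
    (fun N => Finset.aestronglyMeasurable_fun_sum _ fun i _ => hf i) _
    (.of_forall fun x => (hs x).hasSum.comp hu)).trans ?_
  refine Filter.liminf_le_of_frequently_le' (.of_forall fun N => ?_)
  refine le_trans ?_ (ENNReal.sum_le_tsum (u N))
  have := eLpNorm_sum_le (p := p) (f := f) (s := u N) (μ := μ) (fun i _ => hf i) hp
  have e : (fun x => ∑ i ∈ u N, f i x) = ∑ i ∈ u N, f i := by
    ext x
    simp
  rwa [e]

theorem aestronglyMeasurable_tsum {α ι : Type*} [Countable ι] {m : MeasurableSpace α}
    {μ : Measure α} {f : ι → α → ℂ} (hf : ∀ i, AEStronglyMeasurable (f i) μ)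
    (hs : ∀ x, Summable fun i => f i x) : AEStronglyMeasurable (fun x => ∑' i, f i x) μ := by
  obtain ⟨u, hu⟩ := Filter.exists_seq_tendsto (Filter.atTop : Filter (Finset ι))
  exact aestronglyMeasurable_of_tendsto_ae Filter.atTop (f := fun N x => ∑ i ∈ u N, f i x)
    (fun N => Finset.aestronglyMeasurable_fun_sum _ fun i _ => hf i)
    (.of_forall fun x => (hs x).hasSum.comp hu)

/-- The phase `e^{2πi k t / P}`. -/
def phase (P : ℝ) (k : ℤ) (t : ℝ) : ℂ := Complex.exp (Complex.I * (2 * Real.pi / P * k) * t)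

theorem norm_phase (P : ℝ) (k : ℤ) (t : ℝ) : ‖phase P k t‖ = 1 := by
  rw [phase, show Complex.I * (2 * Real.pi / P * k) * (t : ℂ) =
      ((2 * Real.pi / P * k * t : ℝ) : ℂ) * Complex.I by push_cast; ring,
    Complex.norm_exp_ofReal_mul_I]

theorem enorm_phase (P : ℝ) (k : ℤ) (t : ℝ) : ‖phase P k t‖ₑ = 1 := by
  rw [← ofReal_norm, norm_phase, ENNReal.ofReal_one]

theorem continuous_phase (P : ℝ) (k : ℤ) : Continuous (phase P k) := by
  unfold phase; fun_prop

theorem phase_add (P : ℝ) (k l : ℤ) (t : ℝ) : phase P (k + l) t = phase P k t * phase P l t := by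
  rw [phase, phase, phase, ← Complex.exp_add]
  congr 1
  push_cast
  ring

/-- The `n`-th sine coefficient of the boundary integral with boundary datum `∑ a_k e^{2πi k t / P}`,
for `P = 2 M / π`. -/
def modeCoeff (P : ℝ) (M : ℕ) (a : ℤ → ℂ) (n : ℕ) (t : ℝ) : ℂ :=
  t * (2 * Complex.I * Real.pi * (n * a (-(M * n ^ 2)))) * phase P (-(M * n ^ 2)) t +
    ∑' k : ℤ, duhamelCoeff P M a n k * (phase P k t - phase P (-(M * n ^ 2)) t)

variable {P : ℝ} {M : ℕ}

/-- The majorant does not depend on `t`; this uniformity is what gives continuity in time and the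
supremum bound. -/
theorem exists_modeCoeff_bound (hP : 0 < P) (hM : 1 ≤ M) (T : ℝ) :
    ∃ C : ℝ≥0, ∀ a : ℤ → ℂ, ∃ γ : ℕ → ℝ≥0∞,
      (∀ n, ∀ t ∈ Icc 0 T, ‖modeCoeff P M a n t‖ₑ ≤ γ n) ∧
      ∑' n, γ n ^ 2 ≤ C * halfEnergy a := by
  obtain ⟨C, hC⟩ := exists_tsum_tsum_duhamelCoeff_sq_le hP hM
  set A := ENNReal.ofReal (2 * Real.pi * T)
  refine ⟨(2 * A ^ 2 + 2 * 2 ^ 2 * C).toNNReal, fun a =>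
    ⟨fun n => A * ‖(n : ℂ) * a (-(M * n ^ 2))‖ₑ + 2 * ∑' k : ℤ, ‖duhamelCoeff P M a n k‖ₑ,
      fun n t ht => ?_, ?_⟩⟩
  · refine (enorm_add_le _ _).trans (add_le_add ?_ ?_)
    · rw [enorm_mul, enorm_phase, mul_one, ← mul_assoc, enorm_mul]
      gcongr
      rw [← ofReal_norm]
      refine ENNReal.ofReal_le_ofReal ?_
      simp only [norm_mul, Complex.norm_real, Complex.norm_I, Complex.norm_ofNat,
        Real.norm_of_nonneg ht.1, Real.norm_of_nonneg Real.pi_pos.le, mul_one]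
      rw [mul_comm]
      gcongr
      exact ht.2
    · refine enorm_tsum_le_tsum_enorm.trans ?_
      rw [← ENNReal.tsum_mul_left]
      refine ENNReal.tsum_le_tsum fun k => ?_
      rw [enorm_mul, mul_comm]
      gcongr
      refine (enorm_sub_le).trans_eq ?_
      rw [enorm_phase, enorm_phase, one_add_one_eq_two]
  · have hsq : ∀ x y : ℝ≥0∞, (x + y) ^ 2 ≤ 2 * x ^ 2 + 2 * y ^ 2 := by
      intro x y
      have h := ENNReal.tsum_mul_sq_le (fun _ : Bool => 1) (fun b => if b then x else y)
      simp only [tsum_fintype, Fintype.sum_bool] at h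
      rw [← mul_add]
      simpa [one_add_one_eq_two] using h
    rw [ENNReal.coe_toNNReal (by finiteness)]
    refine (ENNReal.tsum_le_tsum fun n => hsq _ _).trans ?_
    simp only [mul_pow A, mul_pow (2 : ℝ≥0∞)]
    rw [ENNReal.tsum_add, ENNReal.tsum_mul_left, ENNReal.tsum_mul_left, ENNReal.tsum_mul_left,
      ENNReal.tsum_mul_left, add_mul, mul_assoc, mul_assoc, mul_assoc]
    gcongr
    · exact tsum_resonant_le hM a
    · exact hC a

theorem summable_duhamelCoeff (hP : 0 < P) (hM : 1 ≤ M) {a : ℤ → ℂ} (ha : halfEnergy a ≠ ∞)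
    (n : ℕ) : Summable fun k => ‖duhamelCoeff P M a n k‖ := by
  obtain ⟨C, hC⟩ := exists_tsum_tsum_duhamelCoeff_sq_le hP hM
  have h1 : (∑' k : ℤ, ‖duhamelCoeff P M a n k‖ₑ) ^ 2 ≠ ∞ :=
    ne_top_of_le_ne_top (by finiteness) ((ENNReal.le_tsum n).trans (hC a))
  have h2 : ∑' k : ℤ, ‖duhamelCoeff P M a n k‖ₑ ≠ ∞ := fun h => h1 (by simp [h])
  exact (Summable.of_enorm (f := fun k => (‖duhamelCoeff P M a n k‖ : ℝ)) (by simpa using h2))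

/-- Four pieces: `t` times a free solution (resonance), a free solution (the subtracted phases), the
near part as a series of modulated free solutions, and the far part as a series of modulated
functions of `x`. The constant is independent of the finite set, so it passes to the limit. -/
theorem exists_eLpNorm_modeCoeff_le (hP : 0 < P) (hM : 1 ≤ M) {T : ℝ} (hTP : T ≤ P) :
    ∃ C : ℝ≥0, ∀ a : ℤ → ℂ, halfEnergy a ≠ ∞ → ∀ s : Finset ℕ,
      eLpNorm (fun z : ℝ × ℝ => ∑ n ∈ s, modeCoeff P M a n z.2 *
        (Real.sin (n * Real.pi * z.1) : ℂ)) 4 (volume.restrict (Ioo (0 : ℝ) 1 ×ˢ Ioo 0 T)) ≤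
      C * halfEnergy a ^ (1 / 2 : ℝ) := by
  obtain ⟨C₁, hC₁⟩ := exists_tsum_tsum_duhamelCoeff_sq_le hP hM
  obtain ⟨C₂, hC₂⟩ := exists_tsum_rpow_nearCoeff_le hP hM
  obtain ⟨C₃, hC₃⟩ := exists_tsum_rpow_farCoeff_le hP hM
  obtain ⟨C₄, hC₄⟩ := exists_eLpNorm_sum_sine_le hP
  set S := ((2 * P * 2) ^ (1 / 4 : ℝ)).toNNReal
  set ν : Measure (ℝ × ℝ) := volume.restrict (Ioo (0 : ℝ) 1 ×ˢ Ioo 0 T) with hν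
  have hStr : ∀ (s : Finset ℕ) (c : ℕ → ℂ),
      eLpNorm (fun z => ∑ n ∈ s, c n * sineWave P n (-(M * n ^ 2)) z) 4 ν ≤
        S * (∑' n, ‖c n‖ₑ ^ 2) ^ (1 / 2 : ℝ) := by
    intro s c
    refine (eLpNorm_mono_measure _ (restrict_le_cellMeasure hTP)).trans
      ((eLpNorm_sum_schrodinger_le hP hM s c).trans ?_)
    change (S : ℝ≥0∞) * _ ≤ _
    gcongr
    exact ENNReal.sum_le_tsum s
  have hSob : ∀ (s : Finset ℕ) (c : ℕ → ℂ),
      eLpNorm (fun z => ∑ n ∈ s, c n * sineWave P n 0 z) 4 ν ≤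
        C₄ * (∑' n : ℕ, bracket n ^ (3 / 5 : ℝ) * ‖c n‖ₑ ^ 2) ^ (1 / 2 : ℝ) := by
    intro s c
    refine (eLpNorm_mono_measure _ (restrict_le_cellMeasure hTP)).trans ((hC₄ s c).trans ?_)
    refine mul_le_mul_right (ENNReal.rpow_le_rpow ?_ (by norm_num)) _
    exact ENNReal.sum_le_tsum s
  have hphase : ∀ (k : ℤ) (f : ℝ × ℝ → ℂ),
      eLpNorm (fun z => phase P k z.2 * f z) 4 ν = eLpNorm f 4 ν := by
    intro k f
    refine eLpNorm_congr_norm_ae (.of_forall fun z => ?_)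
    rw [norm_mul, norm_phase, one_mul]
  refine ⟨T.toNNReal * (S * (2 * Real.pi).toNNReal) + S * C₁ ^ (1 / 2 : ℝ) + S * C₂ + C₄ * C₃,
    fun a ha s => ?_⟩
  have hD := summable_duhamelCoeff hP hM ha
  have hN : ∀ n, Summable fun k => ‖nearCoeff P M a n k‖ := fun n =>
    (hD n).of_nonneg_of_le (fun _ => norm_nonneg _) fun k => by
      unfold nearCoeff; split_ifs <;> simp
  have hF : ∀ n, Summable fun k => ‖farCoeff P M a n k‖ := fun n =>
    (hD n).of_nonneg_of_le (fun _ => norm_nonneg _) fun k => by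
      unfold farCoeff; split_ifs <;> simp
  have hph : ∀ (t : ℝ) (f : ℤ → ℂ) (g : ℤ → ℤ), (Summable fun k => ‖f k‖) →
      Summable fun k => f k * phase P (g k) t := fun t f g hf =>
    Summable.of_norm (by simpa [norm_phase] using hf)
  set c₁ : ℕ → ℂ := fun n => 2 * Complex.I * Real.pi * (n * a (-(M * n ^ 2)))
  set c₂ : ℕ → ℂ := fun n => ∑' k : ℤ, duhamelCoeff P M a n k
  set f₁ : ℝ × ℝ → ℂ := fun z => ∑ n ∈ s, c₁ n * sineWave P n (-(M * n ^ 2)) z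
  set f₂ : ℝ × ℝ → ℂ := fun z => ∑ n ∈ s, c₂ n * sineWave P n (-(M * n ^ 2)) z
  set g : ℤ → ℝ × ℝ → ℂ := fun l z => phase P l z.2 * ∑ n ∈ s,
    nearCoeff P M a n (l - M * n ^ 2) * sineWave P n (-(M * n ^ 2)) z
  set h : ℤ → ℝ × ℝ → ℂ := fun k z => phase P k z.2 * ∑ n ∈ s,
    farCoeff P M a n k * sineWave P n 0 z
  have hgn : ∀ (n : ℕ) (z : ℝ × ℝ), HasSum (fun l : ℤ => phase P l z.2 *
      (nearCoeff P M a n (l - M * n ^ 2) * sineWave P n (-(M * n ^ 2)) z))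
      ((∑' k : ℤ, nearCoeff P M a n k * phase P k z.2) * (Real.sin (n * Real.pi * z.1) : ℂ)) := by
    intro n z
    have h1 := ((hph z.2 _ (fun k => k) (hN n)).hasSum).mul_right (Real.sin (n * Real.pi * z.1) : ℂ)
    -- Reindexing by `l = k + M n²` factors the `k`-th phase into the `l`-th phase, common to all
    -- `n`, and the free evolution of the mode `n`.
    rw [← (Equiv.subRight ((M : ℤ) * (n : ℤ) ^ 2)).hasSum_iff] at h1
    refine (congrArg (fun f => HasSum f _) (funext fun l => ?_)).mpr h1
    simp only [Function.comp_apply, Equiv.subRight_apply]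
    rw [sub_eq_add_neg l, phase_add]
    simp only [sineWave, phase]
    ring
  have hhn : ∀ (n : ℕ) (z : ℝ × ℝ), HasSum (fun k : ℤ => phase P k z.2 *
      (farCoeff P M a n k * sineWave P n 0 z))
      ((∑' k : ℤ, farCoeff P M a n k * phase P k z.2) * (Real.sin (n * Real.pi * z.1) : ℂ)) := by
    intro n z
    have h1 := ((hph z.2 _ (fun k => k) (hF n)).hasSum).mul_right (Real.sin (n * Real.pi * z.1) : ℂ)
    refine (congrArg (fun f => HasSum f _) (funext fun k => ?_)).mpr h1
    simp only [sineWave, Int.cast_zero, mul_zero, zero_mul, Complex.exp_zero, mul_one]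
    ring
  have hg : ∀ z, HasSum (fun l => g l z) (∑ n ∈ s,
      (∑' k : ℤ, nearCoeff P M a n k * phase P k z.2) * (Real.sin (n * Real.pi * z.1) : ℂ)) := by
    intro z
    simp only [g, Finset.mul_sum]
    exact hasSum_sum fun n _ => hgn n z
  have hh : ∀ z, HasSum (fun k => h k z) (∑ n ∈ s,
      (∑' k : ℤ, farCoeff P M a n k * phase P k z.2) * (Real.sin (n * Real.pi * z.1) : ℂ)) := by
    intro z
    simp only [h, Finset.mul_sum]
    exact hasSum_sum fun n _ => hhn n z
  have hdec : (fun z : ℝ × ℝ => ∑ n ∈ s, modeCoeff P M a n z.2 *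
      (Real.sin (n * Real.pi * z.1) : ℂ)) =
      (((fun z => (z.2 : ℂ) * f₁ z) - f₂) + fun z => ∑' l, g l z) + fun z => ∑' k, h k z := by
    ext z
    simp only [Pi.add_apply, Pi.sub_apply]
    rw [(hg z).tsum_eq, (hh z).tsum_eq]
    simp only [f₁, f₂, Finset.mul_sum, ← Finset.sum_sub_distrib, ← Finset.sum_add_distrib]
    refine Finset.sum_congr rfl fun n _ => ?_
    have e1 : ∑' k : ℤ, duhamelCoeff P M a n k * (phase P k z.2 - phase P (-(M * n ^ 2)) z.2) =
        (∑' k : ℤ, nearCoeff P M a n k * phase P k z.2) +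
        (∑' k : ℤ, farCoeff P M a n k * phase P k z.2) - c₂ n * phase P (-(M * n ^ 2)) z.2 := by
      rw [← Summable.tsum_add (hph z.2 _ (fun k => k) (hN n)) (hph z.2 _ (fun k => k) (hF n)), ← tsum_mul_right,
        ← Summable.tsum_sub ((hph z.2 _ (fun k => k) (hN n)).add (hph z.2 _ (fun k => k) (hF n)))
          ((hD n).of_norm.mul_right _)]
      refine tsum_congr fun k => ?_
      rw [← nearCoeff_add_farCoeff]
      ring
    have e2 : sineWave P n (-(M * n ^ 2)) z =
      (Real.sin (n * Real.pi * z.1) : ℂ) * phase P (-(M * n ^ 2)) z.2 := rfl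
    rw [modeCoeff, e1, e2]
    simp only [c₁]
    ring
  have hcs : ∀ (c : ℕ → ℂ) (d : ℕ → ℤ), Continuous fun z => ∑ n ∈ s, c n * sineWave P n (d n) z :=
    fun c d => continuous_finsetSum _ fun n _ => continuous_const.mul (continuous_sineWave P n _)
  have hgm : ∀ l, AEStronglyMeasurable (g l) ν := fun l =>
    (((continuous_phase P l).comp continuous_snd).mul (hcs _ _)).aestronglyMeasurable
  have hhm : ∀ l, AEStronglyMeasurable (h l) ν := fun l =>
    (((continuous_phase P l).comp continuous_snd).mul (hcs _ _)).aestronglyMeasurable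
  have hf₁m : AEStronglyMeasurable (fun z : ℝ × ℝ => (z.2 : ℂ) * f₁ z) ν :=
    ((Complex.continuous_ofReal.comp continuous_snd).mul (hcs _ _)).aestronglyMeasurable
  have hf₂m : AEStronglyMeasurable f₂ ν := (hcs _ _).aestronglyMeasurable
  have hgsm : AEStronglyMeasurable (fun z => ∑' l, g l z) ν :=
    aestronglyMeasurable_tsum hgm fun z => (hg z).summable
  have hhsm : AEStronglyMeasurable (fun z => ∑' l, h l z) ν :=
    aestronglyMeasurable_tsum hhm fun z => (hh z).summable
  have b₁ : eLpNorm (fun z : ℝ × ℝ => (z.2 : ℂ) * f₁ z) 4 ν ≤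
      (T.toNNReal * (S * (2 * Real.pi).toNNReal) : ℝ≥0) * halfEnergy a ^ (1 / 2 : ℝ) := by
    have h1 : ∀ᵐ z ∂ν, ‖(z.2 : ℂ) * f₁ z‖₊ ≤ T.toNNReal * ‖f₁ z‖₊ := by
      refine (ae_restrict_mem (measurableSet_Ioo.prod measurableSet_Ioo)).mono fun z hz => ?_
      rw [nnnorm_mul]
      gcongr
      rw [← NNReal.coe_le_coe, coe_nnnorm, Complex.norm_real, Real.norm_of_nonneg hz.2.1.le]
      exact hz.2.2.le.trans (Real.le_coe_toNNReal T)
    refine (eLpNorm_le_nnreal_smul_eLpNorm_of_ae_le_mul h1 4).trans ?_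
    rw [ENNReal.smul_def, smul_eq_mul, ENNReal.coe_mul, mul_assoc]
    gcongr
    refine (hStr s c₁).trans ?_
    rw [ENNReal.coe_mul, mul_assoc]
    gcongr
    have e : ∀ n, ‖c₁ n‖ₑ ^ 2 = ((2 * Real.pi).toNNReal : ℝ≥0∞) ^ 2 *
        ‖(n : ℂ) * a (-(M * n ^ 2))‖ₑ ^ 2 := by
      intro n
      simp only [c₁]
      rw [enorm_mul, mul_pow]
      congr 2
      rw [← ofReal_norm]
      simp [ENNReal.ofReal, Real.pi_pos.le, abs_of_nonneg]
    simp only [e]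
    rw [ENNReal.tsum_mul_left, ENNReal.mul_rpow_of_nonneg _ _ (by norm_num),
      ENNReal.sq_rpow_half]
    gcongr
    exact tsum_resonant_le hM a
  have b₂ : eLpNorm f₂ 4 ν ≤ (S * C₁ ^ (1 / 2 : ℝ) : ℝ≥0) * halfEnergy a ^ (1 / 2 : ℝ) := by
    refine (hStr s c₂).trans ?_
    rw [ENNReal.coe_mul, mul_assoc, ENNReal.coe_rpow_of_nonneg _ (by norm_num),
      ← ENNReal.mul_rpow_of_nonneg _ _ (by norm_num)]
    gcongr
    refine le_trans (ENNReal.tsum_le_tsum fun n => ?_) (hC₁ a)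
    gcongr
    exact enorm_tsum_le_tsum_enorm
  have b₃ : eLpNorm (fun z => ∑' l, g l z) 4 ν ≤
      (S * C₂ : ℝ≥0) * halfEnergy a ^ (1 / 2 : ℝ) := by
    refine (eLpNorm_tsum_le (by norm_num) hgm fun z => (hg z).summable).trans ?_
    rw [ENNReal.coe_mul, mul_assoc]
    refine le_trans ?_ (mul_le_mul_right (hC₂ a) _)
    rw [← ENNReal.tsum_mul_left]
    refine ENNReal.tsum_le_tsum fun l => ?_
    rw [hphase]
    exact hStr s _
  have b₄ : eLpNorm (fun z => ∑' l, h l z) 4 ν ≤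
      (C₄ * C₃ : ℝ≥0) * halfEnergy a ^ (1 / 2 : ℝ) := by
    refine (eLpNorm_tsum_le (by norm_num) hhm fun z => (hh z).summable).trans ?_
    rw [ENNReal.coe_mul, mul_assoc]
    refine le_trans ?_ (mul_le_mul_right (hC₃ a) _)
    rw [← ENNReal.tsum_mul_left]
    refine ENNReal.tsum_le_tsum fun l => ?_
    rw [hphase]
    exact hSob s _
  rw [hdec]
  refine (eLpNorm_add_le ((hf₁m.sub hf₂m).add hgsm) hhsm (by norm_num)).trans ?_
  rw [ENNReal.coe_add, ENNReal.coe_add, ENNReal.coe_add, add_mul, add_mul, add_mul]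
  refine add_le_add ((eLpNorm_add_le (hf₁m.sub hf₂m) hgsm (by norm_num)).trans
    (add_le_add ((eLpNorm_sub_le hf₁m hf₂m (by norm_num)).trans (add_le_add b₁ b₂)) b₃)) b₄

end

/-! ### Fourier series on the circle and the tent reflection. -/

noncomputable section

section Circle

open AddCircle

theorem fourier_coe_eq_phase {P : ℝ} (k : ℤ) (t : ℝ) : fourier k (t : AddCircle P) = phase P k t := by
  rw [fourier_coe_apply, phase]
  congr 1
  ring

variable {P : ℝ} [hP : Fact (0 < P)]

theorem tsum_enorm_fourierCoeff_sq {F : AddCircle P → ℂ} (hF : MemLp F 2 haarAddCircle) :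
    ∑' k, ‖fourierCoeff F k‖ₑ ^ 2 = ∫⁻ y, ‖F y‖ₑ ^ 2 ∂haarAddCircle := by
  obtain ⟨f, hf⟩ : ∃ f : Lp ℂ 2 (haarAddCircle : Measure (AddCircle P)), f =ᵐ[haarAddCircle] F :=
    ⟨hF.toLp, hF.coeFn_toLp⟩
  have h := hasSum_sq_fourierCoeff f
  have e : ∫ t, ‖f t‖ ^ 2 ∂haarAddCircle = ∫ t, ‖F t‖ ^ 2 ∂haarAddCircle :=
    integral_congr_ae (hf.mono fun x hx => by simp only [hx])
  rw [e] at h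
  simp only [fourierCoeff_congr_ae hf] at h
  have h2 : ∀ x : ℂ, ‖x‖ₑ ^ 2 = ENNReal.ofReal (‖x‖ ^ 2) := fun x => by
    rw [ENNReal.ofReal_pow (norm_nonneg _), ofReal_norm]
  simp only [h2]
  rw [← ENNReal.ofReal_tsum_of_nonneg (fun _ => by positivity) h.summable, h.tsum_eq,
    ofReal_integral_eq_lintegral_ofReal ((memLp_two_iff_integrable_sq_norm hF.1).1 hF)
      (.of_forall fun _ => by positivity)]

theorem fourierCoeff_translate (F : AddCircle P → ℂ) (δ : AddCircle P) (k : ℤ) :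
    fourierCoeff (fun y => F (y + δ)) k = fourier k δ * fourierCoeff F k := by
  have hmul : ∀ x y : AddCircle P, fourier k (x + y) = fourier k x * fourier k y := by
    intro x y
    simp only [fourier_apply, smul_add, toCircle_add, Circle.coe_mul]
  have h := integral_add_right_eq_self (μ := (haarAddCircle : Measure (AddCircle P)))
    (fun y => fourier (-k) (y - δ) • F y) δ
  simp only [add_sub_cancel_right] at h
  rw [fourierCoeff, h, fourierCoeff, ← integral_const_mul]
  congr 1; ext y
  have h1 : (fourier (-k) (y - δ) : ℂ) = fourier k δ * fourier (-k) y := by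
    rw [fourier_apply, fourier_apply, fourier_apply, ← Circle.coe_mul, ← toCircle_add]
    congr 2
    simp only [smul_sub, neg_smul]
    abel
  rw [h1, smul_eq_mul, smul_eq_mul, mul_assoc]

/-- The Fourier series of a square integrable function may be integrated term by term against
a truncated character. -/
theorem hasSum_fourierCoeff_mul_integral {F : AddCircle P → ℂ} (hF : MemLp F 2 haarAddCircle)
    {t : ℝ} (ht : t ∈ Icc 0 P) (m : ℤ) :
    HasSum (fun k => fourierCoeff F k * ∫ τ in (0 : ℝ)..t, phase P (k + m) τ)
      (∫ τ in (0 : ℝ)..t, phase P m τ * F τ) := by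
  -- The conjugate of the truncated character: the inner product against it is, up to the factor
  -- `1/P` from normalised Haar measure, the integral over `(0, t]`. Its continuity on `L²` allows
  -- termwise pairing with the Fourier series.
  set g₀ : ℝ → ℂ := (Ioc 0 t).indicator (phase P (-m))
  have hg₀ : MemLp g₀ 2 (volume.restrict (Ioc 0 (0 + P))) := by
    refine MemLp.of_bound ((continuous_phase P _).aestronglyMeasurable.indicator
      measurableSet_Ioc) 1 (.of_forall fun x => ?_)
    refine (norm_indicator_le_norm_self _ _).trans (norm_phase P _ _).le
  have hg := hg₀.memLp_liftIoc.haarAddCircle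
  set g : AddCircle P → ℂ := liftIoc P 0 g₀ with hgdef
  obtain ⟨gL, hgL⟩ : ∃ f : Lp ℂ 2 (haarAddCircle : Measure (AddCircle P)), f =ᵐ[haarAddCircle] g :=
    ⟨hg.toLp, hg.coeFn_toLp⟩
  obtain ⟨f, hf⟩ : ∃ f : Lp ℂ 2 (haarAddCircle : Measure (AddCircle P)), f =ᵐ[haarAddCircle] F :=
    ⟨hF.toLp, hF.coeFn_toLp⟩
  have hinner : ∀ (G : AddCircle P → ℂ) (G' : Lp ℂ 2 (haarAddCircle : Measure (AddCircle P))),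
      G' =ᵐ[haarAddCircle] G → inner ℂ gL G' =
        (P : ℂ)⁻¹ * ∫ τ in (0 : ℝ)..t, phase P m τ * G τ := by
    intro G G' hG
    rw [L2.inner_def]
    have e1 : ∫ y, inner ℂ (gL y) (G' y) ∂haarAddCircle =
        ∫ y, (starRingEnd ℂ) (g y) * G y ∂haarAddCircle := by
      refine integral_congr_ae ?_
      filter_upwards [hgL, hG] with y h1 h2
      rw [h1, h2, RCLike.inner_apply']
    rw [e1, integral_haarAddCircle, ← AddCircle.integral_preimage P 0, Complex.real_smul,
      Complex.ofReal_inv, zero_add, intervalIntegral.integral_of_le ht.1]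
    congr 1
    have e2 : ∫ a in Ioc 0 P, (starRingEnd ℂ) (g a) * G a =
        ∫ a in Ioc 0 P, (Ioc 0 t).indicator (fun τ => phase P m τ * G τ) a := by
      refine setIntegral_congr_fun measurableSet_Ioc fun a ha => ?_
      simp only [hgdef]
      rw [liftIoc_coe_apply (by simpa using ha)]
      by_cases hat : a ∈ Ioc 0 t
      · simp only [g₀, indicator_of_mem hat]
        rw [← fourier_coe_eq_phase, ← fourier_coe_eq_phase, fourier_neg, Complex.conj_conj]
      · simp [g₀, indicator_of_notMem hat]
    rw [e2, setIntegral_indicator measurableSet_Ioc, inter_eq_self_of_subset_right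
      (Ioc_subset_Ioc_right ht.2)]
  have h := (hasSum_fourier_series_L2 f).mapL (innerSL ℂ gL)
  simp only [innerSL_apply_apply, inner_smul_right] at h
  rw [hinner F _ hf] at h
  have h' := h.mul_left (P : ℂ)
  have hP0 : (P : ℂ) ≠ 0 := by exact_mod_cast hP.out.ne'
  rw [mul_inv_cancel_left₀ hP0] at h'
  refine (congrArg (fun f => HasSum f _) (funext fun k => ?_)).mpr h'
  rw [fourierCoeff_congr_ae hf, hinner (fourier k) _ (coeFn_fourierLp 2 k),
    mul_left_comm, mul_inv_cancel_left₀ hP0]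
  congr 2
  ext τ
  rw [fourier_coe_eq_phase, add_comm k, phase_add]

end Circle

theorem lintegral_Ioo_le_add (f : ℝ → ℝ≥0∞) (a b c : ℝ) :
    ∫⁻ s in Ioo a c, f s ≤ (∫⁻ s in Ioo a b, f s) + ∫⁻ s in Ioo b c, f s := by
  have h : Ioo a c ⊆ Ioo a b ∪ Ico b c := fun x hx => by
    rcases lt_or_ge x b with h | h
    · exact Or.inl ⟨hx.1, h⟩
    · exact Or.inr ⟨h, hx.2⟩
  refine (lintegral_mono_set h).trans ((lintegral_union_le _ _ _).trans_eq ?_)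
  rw [Measure.restrict_congr_set (Ioo_ae_eq_Ico (μ := volume) (a := b) (b := c))]

theorem lintegral_comp_affine_le (G : ℝ → ℝ≥0∞) {φ : ℝ → ℝ} {α β u v T : ℝ} (hα : α ≠ 0)
    (hφ : ∀ s ∈ Ioo u v, φ s = α * s + β) (hmaps : ∀ s ∈ Ioo u v, φ s ∈ Ioo 0 T) :
    ∫⁻ s in Ioo u v, G (φ s) ≤ ENNReal.ofReal |α|⁻¹ * ∫⁻ s in Ioo 0 T, G s := by
  have hinj : InjOn φ (Ioo u v) := fun x hx y hy h => by
    rw [hφ x hx, hφ y hy] at h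
    exact mul_left_cancel₀ hα (by linarith)
  have hder : ∀ x ∈ Ioo u v, HasDerivWithinAt φ α (Ioo u v) x := fun x hx => by
    have : HasDerivWithinAt (fun s => α * s + β) α (Ioo u v) x := by
      simpa using (((hasDerivAt_id x).const_mul α).add_const β).hasDerivWithinAt
    exact this.congr hφ (hφ x hx)
  have h := lintegral_image_eq_lintegral_abs_deriv_mul measurableSet_Ioo hder hinj G
  rw [lintegral_const_mul' _ _ ENNReal.ofReal_ne_top] at h
  have h2 : ∫⁻ s in Ioo u v, G (φ s) = ENNReal.ofReal |α|⁻¹ * ∫⁻ x in φ '' Ioo u v, G x := by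
    rw [h, ← mul_assoc, ← ENNReal.ofReal_mul (by positivity),
      inv_mul_cancel₀ (abs_ne_zero.2 hα), ENNReal.ofReal_one, one_mul]
  rw [h2]
  gcongr
  rintro _ ⟨s, hs, rfl⟩
  exact hmaps s hs

/-- Two periods, on `[0, 2P]`, of the `P`-periodic tent function which is `s ↦ s` on `[0,T]` and
decreases linearly from `T` to `0` on `[T,P]`. -/
def tent (T P s : ℝ) : ℝ :=
  max (min s (T / (P - T) * (P - s))) (min (s - P) (T / (P - T) * (2 * P - s)))

section Tent

variable {T P : ℝ}

theorem continuous_tent : Continuous (tent T P) := by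
  unfold tent; fun_prop

theorem tent_of_mem_Icc (hT : 0 < T) (hTP : 2 * T ≤ P) {s : ℝ} (hs : s ∈ Icc 0 T) :
    tent T P s = s := by
  have hc : T / (P - T) * (P - T) = T := div_mul_cancel₀ _ (by linarith)
  have hc0 : 0 < T / (P - T) := div_pos hT (by linarith)
  have h1 : s ≤ T / (P - T) * (P - s) := by nlinarith [hs.1, hs.2]
  rw [tent, min_eq_left h1, max_eq_left]
  exact (min_le_left _ _).trans (by linarith)

theorem tent_of_mem_Icc' (hT : 0 < T) (hTP : 2 * T ≤ P) {s : ℝ} (hs : s ∈ Icc T P) :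
    tent T P s = T / (P - T) * (P - s) := by
  have hc : T / (P - T) * (P - T) = T := div_mul_cancel₀ _ (by linarith)
  have hc0 : 0 < T / (P - T) := div_pos hT (by linarith)
  have h1 : T / (P - T) * (P - s) ≤ s := by nlinarith [hs.1, hs.2]
  rw [tent, min_eq_right h1, max_eq_left]
  refine (min_le_left _ _).trans ?_
  have := mul_nonneg hc0.le (sub_nonneg.2 hs.2)
  linarith [hs.2]

theorem tent_add_period (hT : 0 < T) (hTP : 2 * T ≤ P) {s : ℝ} (hs : s ∈ Icc 0 P) :
    tent T P (s + P) = tent T P s := by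
  have hc0 : 0 < T / (P - T) := div_pos hT (by linarith)
  have h0 := mul_nonneg hc0.le (sub_nonneg.2 hs.2)
  have h1 : 0 ≤ min s (T / (P - T) * (P - s)) := le_min hs.1 h0
  have h2 : min (s - P) (T / (P - T) * (2 * P - s)) ≤ 0 :=
    (min_le_left _ _).trans (by linarith [hs.2])
  have h3 : min (s + P) (T / (P - T) * (P - (s + P))) ≤ 0 :=
    (min_le_right _ _).trans (by nlinarith [hs.1])
  rw [tent, tent, max_eq_left (h2.trans h1)]
  rw [show s + P - P = s by ring, show 2 * P - (s + P) = P - s by ring, max_eq_right (h3.trans h1)]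

/-- All slopes are at most 1 in absolute value; for `T/(P - T)` this is the condition `2T ≤ P`. -/
theorem abs_tent_sub_le (hT : 0 < T) (hTP : 2 * T ≤ P) (s t : ℝ) :
    |tent T P s - tent T P t| ≤ |s - t| := by
  have hc0 : 0 < T / (P - T) := div_pos hT (by linarith)
  have hc1 : T / (P - T) ≤ 1 := (div_le_one (by linarith)).2 (by linarith)
  have key : ∀ b : ℝ, |T / (P - T) * (b - s) - T / (P - T) * (b - t)| ≤ |s - t| := by
    intro b
    rw [← mul_sub, abs_mul, abs_of_pos hc0, show b - s - (b - t) = -(s - t) by ring, abs_neg]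
    exact mul_le_of_le_one_left (abs_nonneg _) hc1
  refine (abs_max_sub_max_le_max _ _ _ _).trans (max_le ?_ ?_)
  · exact (abs_min_sub_min_le_max _ _ _ _).trans (max_le le_rfl (key P))
  · refine (abs_min_sub_min_le_max _ _ _ _).trans (max_le ?_ (key (2 * P)))
    rw [sub_sub_sub_cancel_right]

theorem tent_mem_Ioo (hT : 0 < T) (hTP : 2 * T ≤ P) {s : ℝ} (hs : s ∈ Ioo 0 T ∪ Ioo T P) :
    tent T P s ∈ Ioo 0 T := by
  have hc : T / (P - T) * (P - T) = T := div_mul_cancel₀ _ (by linarith)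
  have hc0 : 0 < T / (P - T) := div_pos hT (by linarith)
  rcases hs with hs | hs
  · rwa [tent_of_mem_Icc hT hTP (Ioo_subset_Icc_self hs)]
  · rw [tent_of_mem_Icc' hT hTP (Ioo_subset_Icc_self hs)]
    exact ⟨mul_pos hc0 (by linarith [hs.2]), by nlinarith [hs.1]⟩

/-- The two affine pieces contribute their inverse slopes: `1 + (P - T)/T = P/T`. -/
theorem lintegral_comp_tent_le (hT : 0 < T) (hTP : 2 * T ≤ P) (G : ℝ → ℝ≥0∞) :
    ∫⁻ s in Ioo 0 P, G (tent T P s) ≤ ENNReal.ofReal (P / T) * ∫⁻ s in Ioo 0 T, G s := by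
  have hc0 : 0 < T / (P - T) := div_pos hT (by linarith)
  have h1 := lintegral_comp_affine_le G (φ := tent T P) (α := 1) (β := 0) (u := 0) (v := T)
    (T := T) one_ne_zero
    (fun s hs => by rw [tent_of_mem_Icc hT hTP (Ioo_subset_Icc_self hs)]; ring)
    (fun s hs => tent_mem_Ioo hT hTP (Or.inl hs))
  have h2 := lintegral_comp_affine_le G (φ := tent T P) (α := -(T / (P - T)))
    (β := T / (P - T) * P) (u := T) (v := P) (T := T) (by linarith)
    (fun s hs => by rw [tent_of_mem_Icc' hT hTP (Ioo_subset_Icc_self hs)]; ring)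
    (fun s hs => tent_mem_Ioo hT hTP (Or.inr hs))
  refine (lintegral_Ioo_le_add _ 0 T P).trans ((add_le_add h1 h2).trans_eq ?_)
  rw [← add_mul, abs_one, abs_neg, abs_of_pos hc0,
    ← ENNReal.ofReal_add (by norm_num) (by positivity)]
  congr 2
  field_simp
  ring

theorem lintegral_comp_tent_le_two (hT : 0 < T) (hTP : 2 * T ≤ P) (G : ℝ → ℝ≥0∞) :
    ∫⁻ s in Ioo 0 (2 * P), G (tent T P s) ≤
      2 * (ENNReal.ofReal (P / T) * ∫⁻ s in Ioo 0 T, G s) := by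
  have h1 := lintegral_comp_tent_le hT hTP G
  have h2 : ∫⁻ s in Ioo P (2 * P), G (tent T P s) ≤ ∫⁻ s in Ioo 0 P, G (tent T P s) := by
    have := lintegral_comp_affine_le (fun s => G (tent T P s)) (φ := fun s => s - P) (α := 1)
      (β := -P) (u := P) (v := 2 * P) (T := P) one_ne_zero (fun s _ => by ring)
      (fun s hs => ⟨by linarith [hs.1], by linarith [hs.2]⟩)
    rw [abs_one, inv_one, ENNReal.ofReal_one, one_mul] at this
    refine le_trans (le_of_eq ?_) this
    refine setLIntegral_congr_fun measurableSet_Ioo fun s hs => ?_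
    have := tent_add_period hT hTP (s := s - P) ⟨by linarith [hs.1], by linarith [hs.2]⟩
    rw [sub_add_cancel] at this
    simp only [this]
  rw [two_mul (ENNReal.ofReal _ * _)]
  exact (lintegral_Ioo_le_add _ 0 P (2 * P)).trans (add_le_add h1 (h2.trans h1))

end Tent

end

/-! ### The `H^{1/2}` norm and the Fourier coefficients of the extension. -/

noncomputable section

theorem eSobolevHalfNorm_sq (T : ℝ) (h : ℝ → ℂ) : eSobolevHalfNorm T h ^ 2 =
    (∫⁻ t in Ioo 0 T, ‖h t‖ₑ ^ 2) +
      ∫⁻ t in Ioo 0 T, ∫⁻ s in Ioo 0 T, ‖h t - h s‖ₑ ^ 2 / ‖t - s‖ₑ ^ 2 := by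
  rw [eSobolevHalfNorm, ENNReal.rpow_half_sq]

theorem two_le_norm_phase_sub_one_sq {P : ℝ} (hP : 0 < P) {k : ℤ} {δ : ℝ}
    (h1 : P ≤ 4 * |(k : ℝ)| * δ) (h2 : 2 * |(k : ℝ)| * δ ≤ P) :
    2 ≤ ‖phase P k δ - 1‖ ^ 2 := by
  set θ : ℝ := 2 * Real.pi / P * k * δ with hθ
  have hδ : 0 ≤ δ := by
    by_contra hneg
    nlinarith [abs_nonneg (k : ℝ)]
  have e : phase P k δ = Complex.exp (θ * Complex.I) := by
    rw [phase, hθ]; congr 1; push_cast; ring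
  have habs : |θ| = Real.pi / P * (2 * |(k : ℝ)| * δ) := by
    rw [hθ, abs_mul, abs_mul, abs_of_nonneg hδ, abs_of_nonneg (by positivity)]
    ring
  have hcos : Real.cos θ ≤ 0 := by
    rw [← Real.cos_abs]
    refine Real.cos_nonpos_of_pi_div_two_le_of_le ?_ ?_
    · rw [habs, div_mul_eq_mul_div, div_le_div_iff₀ (by norm_num) hP]
      nlinarith [Real.pi_pos]
    · rw [habs]
      have : Real.pi / P * (2 * |(k : ℝ)| * δ) ≤ Real.pi / P * P := by gcongr
      rw [div_mul_cancel₀ _ hP.ne'] at this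
      linarith [Real.pi_pos]
  rw [e, Complex.sq_norm, Complex.normSq_apply]
  simp only [Complex.sub_re, Complex.sub_im, Complex.exp_ofReal_mul_I_re,
    Complex.exp_ofReal_mul_I_im, Complex.one_re, Complex.one_im]
  nlinarith [Real.sin_sq_add_cos_sq θ]

/-- For `δ` between `P/(4|k|)` and `P/(2|k|)` the angle lies in `[π/2, π]`, so the squared numerator
is at least 2. The integrand is at least `8k²/P²` on an interval of length `P/(4|k|)`. -/
theorem le_lintegral_phase_sub_one {P : ℝ} (hP : 0 < P) (k : ℤ) :
    ENNReal.ofReal (2 * |(k : ℝ)| / P) ≤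
      ∫⁻ δ in Ioo 0 (P / 2), ‖phase P k δ - 1‖ₑ ^ 2 / ‖δ‖ₑ ^ 2 := by
  rcases eq_or_ne k 0 with rfl | hk
  · simp
  have hk1 : (1 : ℝ) ≤ |(k : ℝ)| := by
    exact_mod_cast Int.one_le_abs hk
  set u := P / (4 * |(k : ℝ)|)
  set v := P / (2 * |(k : ℝ)|)
  have hsub : Ioo u v ⊆ Ioo 0 (P / 2) := by
    refine Ioo_subset_Ioo (by positivity) ?_
    simp only [v]
    gcongr
    linarith
  calc ENNReal.ofReal (2 * |(k : ℝ)| / P)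
      = ∫⁻ δ in Ioo u v, ENNReal.ofReal (8 * |(k : ℝ)| ^ 2 / P ^ 2) := by
        rw [setLIntegral_const, Real.volume_Ioo, ← ENNReal.ofReal_mul (by positivity)]
        congr 1
        simp only [u, v]
        have : |(k : ℝ)| ≠ 0 := by positivity
        field_simp
        norm_num
    _ ≤ ∫⁻ δ in Ioo u v, ‖phase P k δ - 1‖ₑ ^ 2 / ‖δ‖ₑ ^ 2 := by
        refine setLIntegral_mono' measurableSet_Ioo fun δ hδ => ?_
        have hu : 0 < u := by positivity
        have hδ0 : 0 < δ := hu.trans hδ.1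
        have h1 : P ≤ 4 * |(k : ℝ)| * δ := by
          have := hδ.1.le
          rw [div_le_iff₀ (by positivity)] at this
          linarith
        have h2 : 2 * |(k : ℝ)| * δ ≤ P := by
          have := hδ.2.le
          rw [le_div_iff₀ (by positivity)] at this
          linarith
        have h3 := two_le_norm_phase_sub_one_sq hP h1 h2
        rw [← ofReal_norm, ← ofReal_norm, Real.norm_of_nonneg hδ0.le,
          ← ENNReal.ofReal_pow (norm_nonneg _), ← ENNReal.ofReal_pow hδ0.le,
          ← ENNReal.ofReal_div_of_pos (by positivity)]
        refine ENNReal.ofReal_le_ofReal ?_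
        rw [div_le_div_iff₀ (by positivity) (by positivity)]
        have h4 : (2 * |(k : ℝ)| * δ) ^ 2 ≤ P ^ 2 := by gcongr
        calc 8 * |(k : ℝ)| ^ 2 * δ ^ 2 = 2 * (2 * |(k : ℝ)| * δ) ^ 2 := by ring
          _ ≤ _ := by gcongr
    _ ≤ _ := lintegral_mono_set hsub

section

open AddCircle

variable {P : ℝ} [hP : Fact (0 < P)]

theorem lintegral_haarAddCircle (f : AddCircle P → ℝ≥0∞) :
    ∫⁻ y, f y ∂haarAddCircle = (ENNReal.ofReal P)⁻¹ * ∫⁻ s in Ioc 0 P, f s := by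
  have h := AddCircle.lintegral_preimage P 0 f
  rw [zero_add] at h
  rw [h, volume_eq_smul_haarAddCircle, lintegral_smul_measure, smul_eq_mul, ← mul_assoc,
    ENNReal.inv_mul_cancel (by simpa using hP.out) ENNReal.ofReal_ne_top, one_mul]

theorem tsum_phase_sub_one_fourierCoeff {F : AddCircle P → ℂ} (hF : MemLp F 2 haarAddCircle)
    (δ : ℝ) : ∑' k, ‖phase P k δ - 1‖ₑ ^ 2 * ‖fourierCoeff F k‖ₑ ^ 2 =
      ∫⁻ y, ‖F (y + (δ : AddCircle P)) - F y‖ₑ ^ 2 ∂haarAddCircle := by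
  have hFδ : MemLp (fun y => F (y + (δ : AddCircle P))) 2 haarAddCircle :=
    hF.comp_measurePreserving (measurePreserving_add_right haarAddCircle (δ : AddCircle P))
  refine Eq.trans ?_ (tsum_enorm_fourierCoeff_sq (hFδ.sub hF))
  refine tsum_congr fun k => ?_
  rw [← mul_pow, ← enorm_mul]
  congr 2
  have h1 : fourierCoeff (fun y => F (y + (δ : AddCircle P)) - F y) k =
      fourierCoeff (fun y => F (y + (δ : AddCircle P))) k - fourierCoeff F k := by
    simp only [fourierCoeff, smul_sub]
    exact integral_sub ((hFδ.integrable (by norm_num)).fourier_smul _)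
      ((hF.integrable (by norm_num)).fourier_smul _)
  rw [h1, fourierCoeff_translate, fourier_coe_eq_phase, sub_mul, one_mul]

end

/-- As the tent is 1-Lipschitz, `|δ|` may be replaced by the smaller distance between tent values.
Each change of variables costs `P/T`; the factor 2 appears because `t + δ` ranges over two periods.
-/
theorem lintegral_tent_gagliardo_le {T P : ℝ} (hT : 0 < T) (hTP : 2 * T ≤ P) {h : ℝ → ℂ}
    (hm : Measurable h) :
    ∫⁻ δ in Ioo 0 (P / 2), ∫⁻ t in Ioo 0 P,
      ‖h (tent T P (t + δ)) - h (tent T P t)‖ₑ ^ 2 / ‖δ‖ₑ ^ 2 ≤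
    2 * ENNReal.ofReal (P / T) ^ 2 *
      ∫⁻ t in Ioo 0 T, ∫⁻ s in Ioo 0 T, ‖h t - h s‖ₑ ^ 2 / ‖t - s‖ₑ ^ 2 := by
  have htm : Measurable (tent T P) := continuous_tent.measurable
  rw [lintegral_lintegral_swap (by
    refine Measurable.aemeasurable ?_
    simp only [Function.uncurry_def]
    fun_prop)]
  calc _ ≤ ∫⁻ t in Ioo 0 P, ∫⁻ s in Ioo 0 (2 * P),
        ‖h (tent T P t) - h (tent T P s)‖ₑ ^ 2 / ‖tent T P t - tent T P s‖ₑ ^ 2 := by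
        refine setLIntegral_mono' measurableSet_Ioo fun t ht => ?_
        have h1 := lintegral_comp_affine_le (fun s => ‖h (tent T P t) - h (tent T P s)‖ₑ ^ 2 /
            ‖tent T P t - tent T P s‖ₑ ^ 2) (φ := fun δ => t + δ) (α := 1) (β := t) (u := 0)
          (v := P / 2) (T := 2 * P) one_ne_zero (fun δ _ => by ring)
          (fun δ hδ => ⟨by linarith [ht.1, hδ.1], by linarith [ht.2, hδ.2]⟩)
        rw [abs_one, inv_one, ENNReal.ofReal_one, one_mul] at h1
        refine le_trans (lintegral_mono fun δ => ?_) h1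
        simp only
        rw [enorm_sub_rev (h (tent T P (t + δ)))]
        refine ENNReal.div_le_div_left ?_ _
        gcongr
        rw [enorm_le_iff_norm_le, Real.norm_eq_abs, Real.norm_eq_abs]
        refine (abs_tent_sub_le hT hTP _ _).trans_eq ?_
        rw [sub_add_cancel_left, abs_neg]
    _ ≤ ∫⁻ t in Ioo 0 P, 2 * (ENNReal.ofReal (P / T) * ∫⁻ s in Ioo 0 T,
        ‖h (tent T P t) - h s‖ₑ ^ 2 / ‖tent T P t - s‖ₑ ^ 2) :=
        lintegral_mono fun t => lintegral_comp_tent_le_two hT hTP fun s =>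
          ‖h (tent T P t) - h s‖ₑ ^ 2 / ‖tent T P t - s‖ₑ ^ 2
    _ ≤ ENNReal.ofReal (P / T) * ∫⁻ t in Ioo 0 T, 2 * (ENNReal.ofReal (P / T) *
        ∫⁻ s in Ioo 0 T, ‖h t - h s‖ₑ ^ 2 / ‖t - s‖ₑ ^ 2) :=
        lintegral_comp_tent_le hT hTP fun t => 2 * (ENNReal.ofReal (P / T) *
        ∫⁻ s in Ioo 0 T, ‖h t - h s‖ₑ ^ 2 / ‖t - s‖ₑ ^ 2)
    _ = _ := by
        rw [lintegral_const_mul' _ _ (by norm_num), lintegral_const_mul' _ _ ENNReal.ofReal_ne_top]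
        ring

/-- The `P`-periodic extension of `h` by the tent reflection. -/
def tentExtension (T P : ℝ) [Fact (0 < P)] (h : ℝ → ℂ) : AddCircle P → ℂ :=
  AddCircle.liftIoc P 0 fun s => h (tent T P s)

section Extension

open AddCircle

variable {T P : ℝ} [hP : Fact (0 < P)]

theorem tentExtension_coe (h : ℝ → ℂ) {s : ℝ} (hs : s ∈ Ioc 0 P) :
    tentExtension T P h s = h (tent T P s) :=
  liftIoc_coe_apply (by simpa using hs)

theorem tentExtension_coe' (hT : 0 < T) (hTP : 2 * T ≤ P) (h : ℝ → ℂ) {s : ℝ}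
    (hs : s ∈ Ioc 0 (2 * P)) : tentExtension T P h s = h (tent T P s) := by
  rcases le_or_gt s P with h1 | h1
  · exact tentExtension_coe h ⟨hs.1, h1⟩
  · have h2 : ((s - P : ℝ) : AddCircle P) = s := by
      rw [coe_sub, coe_period, sub_zero]
    have h3 : s - P ∈ Ioc 0 P := ⟨by linarith, by linarith [hs.2]⟩
    rw [← h2, tentExtension_coe h h3, ← tent_add_period hT hTP (Ioc_subset_Icc_self h3),
      sub_add_cancel]

theorem memLp_tentExtension (hT : 0 < T) (hTP : 2 * T ≤ P) {h : ℝ → ℂ} (hm : Measurable h)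
    (hh : ∫⁻ t in Ioo 0 T, ‖h t‖ₑ ^ 2 ≠ ∞) : MemLp (tentExtension T P h) 2 haarAddCircle := by
  have h1 : MemLp (fun s => h (tent T P s)) 2 (volume.restrict (Ioc 0 (0 + P))) := by
    refine ⟨(hm.comp continuous_tent.measurable).aestronglyMeasurable, ?_⟩
    rw [eLpNorm_lt_top_iff_lintegral_rpow_enorm_lt_top (by norm_num) (by norm_num), zero_add,
      Measure.restrict_congr_set (Ioo_ae_eq_Ioc (μ := volume) (a := 0) (b := P)).symm]
    simp only [ENNReal.toReal_ofNat, ENNReal.rpow_ofNat]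
    refine (lintegral_comp_tent_le hT hTP fun s => ‖h s‖ₑ ^ 2).trans_lt ?_
    exact ENNReal.mul_lt_top ENNReal.ofReal_lt_top hh.lt_top
  exact h1.memLp_liftIoc.haarAddCircle

/-- Parseval for the increments `F(· + δ) - F`, integrated against `dδ/δ²`, turns the double
integral into a multiplier on `|a_k|²` that is at least `2|k|/P`; Parseval for `F` supplies the
remaining `1`. -/
theorem exists_halfEnergy_tentExtension_le (hT : 0 < T) (hTP : 2 * T ≤ P) : ∃ C : ℝ≥0,
    ∀ h : ℝ → ℂ, Measurable h → eSobolevHalfNorm T h ≠ ∞ →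
      halfEnergy (fourierCoeff (tentExtension T P h)) ≤ C * eSobolevHalfNorm T h ^ 2 := by
  have hP0 : 0 < P := hP.out
  refine ⟨((ENNReal.ofReal P)⁻¹ * ENNReal.ofReal (P / T) +
    2 * ENNReal.ofReal (P / T) ^ 2).toNNReal, fun h hm hh => ?_⟩
  rw [ENNReal.coe_toNNReal (by
    have : (ENNReal.ofReal P)⁻¹ ≠ ∞ := by simpa using hP0
    finiteness), eSobolevHalfNorm_sq]
  have hh2 : eSobolevHalfNorm T h ^ 2 ≠ ∞ := by finiteness
  rw [eSobolevHalfNorm_sq] at hh2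
  set A := ∫⁻ t in Ioo 0 T, ‖h t‖ₑ ^ 2
  set G := ∫⁻ t in Ioo 0 T, ∫⁻ s in Ioo 0 T, ‖h t - h s‖ₑ ^ 2 / ‖t - s‖ₑ ^ 2
  have hF := memLp_tentExtension hT hTP hm (ENNReal.add_ne_top.1 hh2).1
  set F := tentExtension T P h
  set a := fourierCoeff F
  have hL2 : ∑' k, ‖a k‖ₑ ^ 2 ≤ (ENNReal.ofReal P)⁻¹ * (ENNReal.ofReal (P / T) * A) := by
    rw [tsum_enorm_fourierCoeff_sq hF, lintegral_haarAddCircle]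
    gcongr
    refine le_trans (le_of_eq ?_) (lintegral_comp_tent_le hT hTP fun s => ‖h s‖ₑ ^ 2)
    rw [Measure.restrict_congr_set (Ioo_ae_eq_Ioc (μ := volume) (a := 0) (b := P))]
    exact setLIntegral_congr_fun measurableSet_Ioc fun s hs => by
      simp only [F, tentExtension_coe h hs]
  have hcirc : ∀ δ ∈ Ioo 0 (P / 2), ∑' k, ‖phase P k δ - 1‖ₑ ^ 2 / ‖δ‖ₑ ^ 2 * ‖a k‖ₑ ^ 2 =
      (ENNReal.ofReal P)⁻¹ * ∫⁻ t in Ioo 0 P,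
        ‖h (tent T P (t + δ)) - h (tent T P t)‖ₑ ^ 2 / ‖δ‖ₑ ^ 2 := by
    intro δ hδ
    have e1 : ∀ k, ‖phase P k δ - 1‖ₑ ^ 2 / ‖δ‖ₑ ^ 2 * ‖a k‖ₑ ^ 2 =
        (‖δ‖ₑ ^ 2)⁻¹ * (‖phase P k δ - 1‖ₑ ^ 2 * ‖a k‖ₑ ^ 2) := fun k => by
      rw [div_eq_mul_inv]; ring
    have hδ0 : (‖δ‖ₑ ^ 2)⁻¹ ≠ ∞ := by
      simp [hδ.1.ne']
    simp only [e1]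
    rw [ENNReal.tsum_mul_left, tsum_phase_sub_one_fourierCoeff hF, lintegral_haarAddCircle,
      mul_left_comm, ← lintegral_const_mul' _ _ hδ0,
      Measure.restrict_congr_set (Ioo_ae_eq_Ioc (μ := volume) (a := 0) (b := P))]
    congr 1
    refine setLIntegral_congr_fun measurableSet_Ioc fun t ht => ?_
    have hF1 : F t = h (tent T P t) := tentExtension_coe h ht
    have hF2 : F ((t + δ : ℝ) : AddCircle P) = h (tent T P (t + δ)) := tentExtension_coe' hT hTP h
      ⟨by linarith [ht.1, hδ.1], by linarith [ht.2, hδ.2]⟩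
    rw [← coe_add, hF1, hF2, mul_comm, div_eq_mul_inv]
  have hG : ∑' k, (∫⁻ δ in Ioo 0 (P / 2), ‖phase P k δ - 1‖ₑ ^ 2 / ‖δ‖ₑ ^ 2) * ‖a k‖ₑ ^ 2 ≤
      (ENNReal.ofReal P)⁻¹ * (2 * ENNReal.ofReal (P / T) ^ 2 * G) := by
    have e1 : ∀ k, (∫⁻ δ in Ioo 0 (P / 2), ‖phase P k δ - 1‖ₑ ^ 2 / ‖δ‖ₑ ^ 2) * ‖a k‖ₑ ^ 2 =
        ∫⁻ δ in Ioo 0 (P / 2), ‖phase P k δ - 1‖ₑ ^ 2 / ‖δ‖ₑ ^ 2 * ‖a k‖ₑ ^ 2 := fun k =>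
      (lintegral_mul_const' _ _ (by finiteness)).symm
    simp only [e1]
    rw [← lintegral_tsum fun k => by
      have := (continuous_phase P k).measurable
      fun_prop, setLIntegral_congr_fun measurableSet_Ioo hcirc,
      lintegral_const_mul' _ _ (by simpa using hP0)]
    gcongr
    exact lintegral_tent_gagliardo_le hT hTP hm
  have hb : ∀ k, bracket k * ‖a k‖ₑ ^ 2 ≤ ‖a k‖ₑ ^ 2 + ENNReal.ofReal P *
      ((∫⁻ δ in Ioo 0 (P / 2), ‖phase P k δ - 1‖ₑ ^ 2 / ‖δ‖ₑ ^ 2) * ‖a k‖ₑ ^ 2) := by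
    intro k
    have h1 : bracket k ≤ 1 + ENNReal.ofReal P * ENNReal.ofReal (2 * |(k : ℝ)| / P) := by
      rw [bracket_eq_ofReal, ← ENNReal.ofReal_mul hP0.le, ← ENNReal.ofReal_one,
        ← ENNReal.ofReal_add zero_le_one (by positivity)]
      refine ENNReal.ofReal_le_ofReal ?_
      rw [mul_div_cancel₀ _ hP0.ne', Nat.cast_natAbs, Int.cast_abs]
      linarith [abs_nonneg (k : ℝ)]
    calc _ ≤ (1 + ENNReal.ofReal P *
          ∫⁻ δ in Ioo 0 (P / 2), ‖phase P k δ - 1‖ₑ ^ 2 / ‖δ‖ₑ ^ 2) * ‖a k‖ₑ ^ 2 := by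
          gcongr
          exact h1.trans (by gcongr; exact le_lintegral_phase_sub_one hP0 k)
      _ = _ := by ring
  calc halfEnergy a ≤ _ := ENNReal.tsum_le_tsum hb
    _ ≤ (ENNReal.ofReal P)⁻¹ * (ENNReal.ofReal (P / T) * A) +
        ENNReal.ofReal P * ((ENNReal.ofReal P)⁻¹ * (2 * ENNReal.ofReal (P / T) ^ 2 * G)) := by
        rw [ENNReal.tsum_add, ENNReal.tsum_mul_left]
        gcongr
    _ = (ENNReal.ofReal P)⁻¹ * ENNReal.ofReal (P / T) * A +
        2 * ENNReal.ofReal (P / T) ^ 2 * G := by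
        rw [← mul_assoc (ENNReal.ofReal P), ENNReal.mul_inv_cancel (by simpa using hP0)
          ENNReal.ofReal_ne_top, one_mul]
        ring
    _ ≤ _ := by
        rw [mul_add]
        gcongr
        · exact le_self_add
        · exact le_add_self

end Extension

end

/-! ### Explicit form of the boundary coefficients. -/

noncomputable section

theorem integral_phase_zero (P t : ℝ) : ∫ τ in (0 : ℝ)..t, phase P 0 τ = t := by
  simp [phase]

theorem integral_phase {P : ℝ} (hP : 0 < P) {l : ℤ} (hl : l ≠ 0) (t : ℝ) :
    ∫ τ in (0 : ℝ)..t, phase P l τ = P / (2 * Complex.I * Real.pi * l) * (phase P l t - 1) := by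
  have hP' : (P : ℂ) ≠ 0 := by exact_mod_cast hP.ne'
  have hπ : (Real.pi : ℂ) ≠ 0 := by exact_mod_cast Real.pi_ne_zero
  have hl' : (l : ℂ) ≠ 0 := by exact_mod_cast hl
  simp only [phase]
  rw [integral_exp_mul_complex (mul_ne_zero Complex.I_ne_zero (by simp [hP', hl']))]
  simp only [Complex.ofReal_zero, mul_zero, Complex.exp_zero]
  field_simp

theorem boundaryCoeff_eq_modeCoeff {T P : ℝ} [hP : Fact (0 < P)] {M : ℕ} (hM : 1 ≤ M)
    (hPM : P = 2 * M / Real.pi) (hT : 0 < T) (hTP : 2 * T ≤ P) {h : ℝ → ℂ} (hm : Measurable h)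
    (hh : eSobolevHalfNorm T h ≠ ∞) (n : ℕ) {t : ℝ} (ht : t ∈ Icc 0 T) :
    boundaryCoeff h n t = modeCoeff P M (fourierCoeff (tentExtension T P h)) n t := by
  have hP0 : 0 < P := hP.out
  have hM0 : (M : ℂ) ≠ 0 := by
    have : M ≠ 0 := by omega
    exact_mod_cast this
  have hP' : (P : ℂ) ≠ 0 := by exact_mod_cast hP0.ne'
  have hπ : (Real.pi : ℂ) ≠ 0 := by exact_mod_cast Real.pi_ne_zero
  have hPC : (P : ℂ) = 2 * M / Real.pi := by rw [hPM]; push_cast; rfl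
  have hh2 : eSobolevHalfNorm T h ^ 2 ≠ ∞ := by finiteness
  rw [eSobolevHalfNorm_sq] at hh2
  have hF := memLp_tentExtension hT hTP hm (ENNReal.add_ne_top.1 hh2).1
  set a := fourierCoeff (tentExtension T P h)
  set m : ℤ := M * n ^ 2 with hmdef
  -- This is where `P = 2M/π` is used: `(2π/P) M n² = (nπ)²`.
  have hfreq : ∀ τ : ℝ, Complex.exp (Complex.I * ((n * Real.pi : ℝ) : ℂ) ^ 2 * τ) =
      phase P m τ := by
    intro τ
    rw [phase, hPC, hmdef]
    congr 1
    push_cast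
    field_simp
  have hfreq' : Complex.exp (-Complex.I * ((n * Real.pi : ℝ) : ℂ) ^ 2 * t) = phase P (-m) t := by
    rw [phase, hPC, hmdef]
    congr 1
    push_cast
    field_simp
  have hint : ∫ τ in (0 : ℝ)..t, phase P m τ * tentExtension T P h τ =
      ∫ τ in (0 : ℝ)..t, phase P m τ * h τ := by
    rw [intervalIntegral.integral_of_le ht.1, intervalIntegral.integral_of_le ht.1]
    refine setIntegral_congr_fun measurableSet_Ioc fun τ hτ => ?_
    have h1 : τ ≤ T := hτ.2.trans ht.2
    rw [tentExtension_coe h ⟨hτ.1, by linarith⟩, tent_of_mem_Icc hT hTP ⟨hτ.1.le, h1⟩]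
  have hs := hasSum_fourierCoeff_mul_integral hF (t := t) ⟨ht.1, by linarith [ht.2]⟩ m
  rw [hint] at hs
  -- The single index `k = -m` has a constant integrand and produces the factor `t`; every other
  -- index integrates to a difference of phases.
  have hterm : ∀ k : ℤ, 2 * Complex.I * n * Real.pi * phase P (-m) t *
      (a k * ∫ τ in (0 : ℝ)..t, phase P (k + m) τ) =
      (if k = -m then t * (2 * Complex.I * Real.pi * (n * a (-m))) * phase P (-m) t else 0) +
      duhamelCoeff P M a n k * (phase P k t - phase P (-m) t) := by
    intro k
    rw [duhamelCoeff]
    by_cases hk : k + m = 0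
    · have hk' : k = -m := by omega
      rw [if_pos hk', if_pos hk, hk, integral_phase_zero, hk']
      ring
    · have hk' : k ≠ -m := by omega
      have hl : (k : ℂ) + m ≠ 0 := by exact_mod_cast hk
      rw [if_neg hk', if_neg hk, integral_phase hP0 hk, zero_add]
      have e : phase P k t = phase P (k + m) t * phase P (-m) t := by
        rw [← phase_add]; congr 1; ring
      have hden : ((k + M * n ^ 2 : ℤ) : ℂ) = k + m := by rw [hmdef]; push_cast; ring
      rw [e, hden]
      field_simp
  have hs2 := hs.mul_left (2 * Complex.I * n * Real.pi * phase P (-m) t)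
  rw [funext hterm] at hs2
  have hs3 := hs2.sub (hasSum_ite_eq (-m)
    (t * (2 * Complex.I * Real.pi * (n * a (-m))) * phase P (-m) t))
  simp only [add_sub_cancel_left] at hs3
  rw [modeCoeff, hs3.tsum_eq, boundaryCoeff, hfreq']
  simp only [hfreq]
  ring

end

/-! ### Sine series in `L²(0,1)` depending on time. -/

noncomputable section

open Filter Topology

theorem integral_cos_int_mul_pi {k : ℤ} (hk : k ≠ 0) :
    ∫ x in (0 : ℝ)..1, Real.cos (k * Real.pi * x) = 0 := by
  have hc : (k : ℝ) * Real.pi ≠ 0 := mul_ne_zero (by exact_mod_cast hk) Real.pi_ne_zero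
  rw [intervalIntegral.integral_comp_mul_left _ hc]
  simp [Real.sin_int_mul_pi]

theorem integral_sin_mul_sin_eq_zero {n m : ℕ} (h : n ≠ m) :
    ∫ x in (0 : ℝ)..1, Real.sin (n * Real.pi * x) * Real.sin (m * Real.pi * x) = 0 := by
  have e : ∀ x : ℝ, Real.sin (n * Real.pi * x) * Real.sin (m * Real.pi * x) =
      2⁻¹ * Real.cos (((n - m : ℤ) : ℝ) * Real.pi * x) -
      2⁻¹ * Real.cos (((n + m : ℤ) : ℝ) * Real.pi * x) := by
    intro x
    have := Real.two_mul_sin_mul_sin (n * Real.pi * x) (m * Real.pi * x)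
    rw [← sub_mul, ← sub_mul, ← add_mul, ← add_mul] at this
    push_cast
    linarith
  simp only [e]
  rw [intervalIntegral.integral_sub (Continuous.intervalIntegrable (by fun_prop) _ _)
    (Continuous.intervalIntegrable (by fun_prop) _ _), intervalIntegral.integral_const_mul,
    intervalIntegral.integral_const_mul, integral_cos_int_mul_pi (by omega),
    integral_cos_int_mul_pi (by omega)]
  simp

theorem coeFn_sineMode (n : ℕ) : sineMode n =ᵐ[volume.restrict (Ioo (0 : ℝ) 1)]
    fun x : ℝ => ((Real.sin (n * Real.pi * x) : ℝ) : ℂ) :=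
  (memLp_sineMode n).coeFn_toLp

theorem inner_sineMode {n m : ℕ} (h : n ≠ m) : inner ℂ (sineMode n) (sineMode m) = 0 := by
  rw [L2.inner_def]
  have e : ∫ x, inner ℂ (sineMode n x) (sineMode m x) ∂(volume.restrict (Ioo (0 : ℝ) 1)) =
      ∫ x in Ioo (0 : ℝ) 1,
        ((Real.sin (n * Real.pi * x) * Real.sin (m * Real.pi * x) : ℝ) : ℂ) := by
    refine integral_congr_ae ?_
    filter_upwards [coeFn_sineMode n, coeFn_sineMode m] with x h1 h2
    rw [h1, h2, RCLike.inner_apply', Complex.conj_ofReal, Complex.ofReal_mul]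
  rw [e, integral_complex_ofReal, ← integral_Ioc_eq_integral_Ioo,
    ← intervalIntegral.integral_of_le zero_le_one, integral_sin_mul_sin_eq_zero h,
    Complex.ofReal_zero]

theorem norm_sineMode_le (n : ℕ) : ‖sineMode n‖ ≤ 1 := by
  rw [sineMode, Lp.norm_toLp]
  refine ENNReal.toReal_le_of_le_ofReal zero_le_one ?_
  refine (eLpNorm_le_of_ae_bound (C := 1) (.of_forall fun x => ?_)).trans ?_
  · rw [Complex.norm_real]
    exact Real.abs_sin_le_one _
  · simp

/-- The modes are orthogonal with norm at most 1. The injection `σ` lets the same bound serve for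
tails of the series. -/
theorem norm_sum_sineMode_sq_le {ι : Type*} {σ : ι → ℕ} (hσ : Function.Injective σ)
    (c : ι → ℂ) (s : Finset ι) :
    ‖∑ i ∈ s, c i • sineMode (σ i)‖ ^ 2 ≤ ∑ i ∈ s, ‖c i‖ ^ 2 := by
  classical
  induction s using Finset.induction_on with
  | empty => simp
  | insert a s ha ih =>
    rw [Finset.sum_insert ha, Finset.sum_insert ha, sq,
      norm_add_sq_eq_norm_sq_add_norm_sq_of_inner_eq_zero (𝕜 := ℂ), ← sq, ← sq]
    · refine add_le_add ?_ ih
      rw [norm_smul]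
      gcongr
      exact mul_le_of_le_one_right (norm_nonneg _) (norm_sineMode_le _)
    · rw [inner_sum]
      refine Finset.sum_eq_zero fun i hi => ?_
      rw [inner_smul_left, inner_smul_right, inner_sineMode, mul_zero, mul_zero]
      exact fun h => ha (hσ h ▸ hi)

theorem summable_norm_sq_of_tsum_ne_top {ι : Type*} {c : ι → ℂ} (hc : ∑' i, ‖c i‖ₑ ^ 2 ≠ ∞) :
    Summable fun i => ‖c i‖ ^ 2 :=
  Summable.of_enorm (f := fun i => ‖c i‖ ^ 2) (by simpa [enorm_pow] using hc)

theorem summable_smul_sineMode {ι : Type*} {σ : ι → ℕ} (hσ : Function.Injective σ) {c : ι → ℂ}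
    (hc : ∑' i, ‖c i‖ₑ ^ 2 ≠ ∞) : Summable fun i => c i • sineMode (σ i) := by
  rw [summable_iff_vanishing_norm]
  intro ε hε
  obtain ⟨s, hs⟩ := summable_iff_vanishing_norm.1 (summable_norm_sq_of_tsum_ne_top hc) (ε ^ 2)
    (by positivity)
  refine ⟨s, fun t ht => lt_of_pow_lt_pow_left₀ 2 hε.le ?_⟩
  refine (norm_sum_sineMode_sq_le hσ c t).trans_lt ((le_abs_self _).trans_lt ?_)
  exact hs t ht

theorem enorm_tsum_smul_sineMode_le {ι : Type*} {σ : ι → ℕ} (hσ : Function.Injective σ)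
    {c : ι → ℂ} (hc : ∑' i, ‖c i‖ₑ ^ 2 ≠ ∞) :
    ‖∑' i, c i • sineMode (σ i)‖ₑ ≤ (∑' i, ‖c i‖ₑ ^ 2) ^ (1 / 2 : ℝ) := by
  refine ENNReal.le_rpow_half_of_sq_le ?_
  have h1 := (((ENNReal.continuous_pow 2).comp continuous_enorm).tendsto _).comp (summable_smul_sineMode hσ hc).hasSum
  refine le_of_tendsto h1 (.of_forall fun s => ?_)
  refine le_trans ?_ (ENNReal.sum_le_tsum s)
  simp only [Function.comp_apply]
  have h2 : ∀ x : ℂ, ‖x‖ₑ ^ 2 = ENNReal.ofReal (‖x‖ ^ 2) := fun x => by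
    rw [ENNReal.ofReal_pow (norm_nonneg _), ofReal_norm]
  simp only [h2]
  rw [← ENNReal.ofReal_sum_of_nonneg fun i _ => by positivity, ← ofReal_norm,
    ← ENNReal.ofReal_pow (norm_nonneg _)]
  exact ENNReal.ofReal_le_ofReal (norm_sum_sineMode_sq_le hσ c s)

section Series

variable {T : ℝ} {c : ℕ → ℝ → ℂ} {γ : ℕ → ℝ≥0∞}

theorem enorm_tsum_sub_sum_le (hb : ∀ n, ∀ t ∈ Icc 0 T, ‖c n t‖ₑ ≤ γ n)
    (hγ : ∑' n, γ n ^ 2 ≠ ∞) (N : ℕ) {t : ℝ} (ht : t ∈ Icc 0 T) :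
    ‖(∑' n, c n t • sineMode n) - ∑ n ∈ Finset.range N, c n t • sineMode n‖ₑ ≤
      (∑' n, γ (n + N) ^ 2) ^ (1 / 2 : ℝ) := by
  have h0 : ∀ N : ℕ, ∑' n, ‖c (n + N) t‖ₑ ^ 2 ≤ ∑' n, γ (n + N) ^ 2 := fun N =>
    ENNReal.tsum_le_tsum fun n => pow_le_pow_left' (hb _ t ht) 2
  have h1 : ∀ N : ℕ, ∑' n, ‖c (n + N) t‖ₑ ^ 2 ≠ ∞ := fun N =>
    ne_top_of_le_ne_top hγ ((h0 N).trans (ENNReal.tsum_comp_le_tsum_of_injective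
      (add_left_injective N) fun n => γ n ^ 2))
  have hs := summable_smul_sineMode (σ := fun n => n) (c := fun n => c n t)
    Function.injective_id (h1 0)
  rw [← hs.sum_add_tsum_nat_add N, add_sub_cancel_left]
  refine (enorm_tsum_smul_sineMode_le (σ := fun n => n + N) (add_left_injective N)
    (h1 N)).trans ?_
  exact ENNReal.rpow_le_rpow (h0 N) (by norm_num)

theorem summable_series (hb : ∀ n, ∀ t ∈ Icc 0 T, ‖c n t‖ₑ ≤ γ n)
    (hγ : ∑' n, γ n ^ 2 ≠ ∞) {t : ℝ} (ht : t ∈ Icc 0 T) :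
    Summable fun n => c n t • sineMode n :=
  summable_smul_sineMode (σ := fun n => n) Function.injective_id
    (ne_top_of_le_ne_top hγ (ENNReal.tsum_le_tsum fun n => pow_le_pow_left' (hb n t ht) 2))

theorem enorm_series_le (hb : ∀ n, ∀ t ∈ Icc 0 T, ‖c n t‖ₑ ≤ γ n)
    (hγ : ∑' n, γ n ^ 2 ≠ ∞) {t : ℝ} (ht : t ∈ Icc 0 T) :
    ‖∑' n, c n t • sineMode n‖ₑ ≤ (∑' n, γ n ^ 2) ^ (1 / 2 : ℝ) := by
  simpa using enorm_tsum_sub_sum_le hb hγ 0 ht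

theorem tendsto_tail (hγ : ∑' n, γ n ^ 2 ≠ ∞) :
    Tendsto (fun N => (∑' n, γ (n + N) ^ 2) ^ (1 / 2 : ℝ)) atTop (𝓝 0) := by
  have h := (ENNReal.tendsto_sum_nat_add _ hγ).ennrpow_const (1 / 2 : ℝ)
  simpa using h

theorem continuousOn_series (hc : ∀ n, Continuous (c n))
    (hb : ∀ n, ∀ t ∈ Icc 0 T, ‖c n t‖ₑ ≤ γ n) (hγ : ∑' n, γ n ^ 2 ≠ ∞) :
    ContinuousOn (fun t => ∑' n, c n t • sineMode n) (Icc 0 T) := by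
  have hu : TendstoUniformlyOn (fun N t => ∑ n ∈ Finset.range N, c n t • sineMode n)
      (fun t => ∑' n, c n t • sineMode n) atTop (Icc 0 T) := by
    rw [EMetric.tendstoUniformlyOn_iff]
    intro ε hε
    filter_upwards [(tendsto_tail hγ).eventually_lt_const hε] with N hN t ht
    rw [edist_eq_enorm_sub]
    exact (enorm_tsum_sub_sum_le hb hγ N ht).trans_lt hN
  exact hu.continuousOn (.of_forall fun N =>
    (continuous_finsetSum _ fun n _ => (hc n).smul continuous_const).continuousOn)

theorem coeFn_sum_smul_sineMode (s : Finset ℕ) (d : ℕ → ℂ) :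
    (∑ n ∈ s, d n • sineMode n : L2Unit) =ᵐ[volume.restrict (Ioo (0 : ℝ) 1)]
      fun x => ∑ n ∈ s, d n * (Real.sin (n * Real.pi * x) : ℂ) := by
  have h : ∀ n, (d n • sineMode n : L2Unit) =ᵐ[volume.restrict (Ioo (0 : ℝ) 1)]
      fun x => d n * (Real.sin (n * Real.pi * x) : ℂ) := fun n => by
    filter_upwards [Lp.coeFn_smul (d n) (sineMode n), coeFn_sineMode n] with x h1 h2
    rw [h1, Pi.smul_apply, h2, smul_eq_mul]
  filter_upwards [Lp.coeFn_fun_finsetSum s fun n => d n • sineMode n, ae_all_iff.2 h] with x h1 h2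
  rw [h1]
  exact Finset.sum_congr rfl fun n _ => h2 n

/-- Elements of `L²(0,1)` chosen separately for each `t` need not form a measurable function of
`(x,t)`. Instead the limit is taken of jointly continuous partial sums, along one subsequence that
works for all `t`. -/
theorem exists_joint_representative (hc : ∀ n, Continuous (c n))
    (hb : ∀ n, ∀ t ∈ Icc 0 T, ‖c n t‖ₑ ≤ γ n) (hγ : ∑' n, γ n ^ 2 ≠ ∞) {Q : ℝ≥0∞}
    (hQ : ∀ s : Finset ℕ, eLpNorm (fun z : ℝ × ℝ => ∑ n ∈ s, c n z.2 *
      (Real.sin (n * Real.pi * z.1) : ℂ)) 4 (volume.restrict (Ioo (0 : ℝ) 1 ×ˢ Ioo 0 T)) ≤ Q) :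
    ∃ U : ℝ × ℝ → ℂ,
      (∀ t ∈ Icc 0 T, ∀ᵐ x ∂(volume.restrict (Ioo (0 : ℝ) 1)),
        U (x, t) = (∑' n, c n t • sineMode n : L2Unit) x) ∧
      AEStronglyMeasurable U (volume.restrict (Ioo (0 : ℝ) 1 ×ˢ Ioo 0 T)) ∧
      eLpNorm U 4 (volume.restrict (Ioo (0 : ℝ) 1 ×ˢ Ioo 0 T)) ≤ Q := by
  set μ : Measure ℝ := volume.restrict (Ioo (0 : ℝ) 1)
  set tail : ℕ → ℝ≥0∞ := fun N => (∑' n, γ (n + N) ^ 2) ^ (1 / 2 : ℝ)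
  have hε : ∀ j : ℕ, (0 : ℝ≥0∞) < 2⁻¹ ^ j := fun j => ENNReal.pow_pos (by simp) j
  -- Tails below `2^{-j}` uniformly in `t` make the partial sums Cauchy at a summable rate, hence
  -- convergent for almost every `x` at each `t`.
  obtain ⟨φ, -, hφt⟩ := Filter.extraction_forall_of_eventually fun j : ℕ =>
    (tendsto_tail hγ).eventually_lt_const (hε j)
  set u : ℝ → L2Unit := fun t => ∑' n, c n t • sineMode n
  set p : ℕ → ℝ → L2Unit := fun j t => ∑ n ∈ Finset.range (φ j), c n t • sineMode n
  set W : ℕ → ℝ × ℝ → ℂ := fun j z => ∑ n ∈ Finset.range (φ j), c n z.2 *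
      (Real.sin (n * Real.pi * z.1) : ℂ)
  have hW : ∀ j, Continuous (W j) := fun j => continuous_finsetSum _ fun n _ =>
    ((hc n).comp continuous_snd).mul (by fun_prop)
  have hpW : ∀ j t, p j t =ᵐ[μ] fun x => W j (x, t) := fun j t =>
    coeFn_sum_smul_sineMode (Finset.range (φ j)) fun n => c n t
  have hup : ∀ j, ∀ t ∈ Icc 0 T, ‖u t - p j t‖ₑ < 2⁻¹ ^ j := fun j t ht =>
    (enorm_tsum_sub_sum_le hb hγ (φ j) ht).trans_lt (hφt j)
  have hWm : ∀ j t, AEStronglyMeasurable (fun x => W j (x, t)) μ := fun j t =>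
    ((hW j).comp (by fun_prop)).aestronglyMeasurable
  have hlim : ∀ t ∈ Icc 0 T, ∀ᵐ x ∂μ, Tendsto (fun j => W j (x, t)) atTop (𝓝 (u t x)) := by
    intro t ht
    have h1 : ∀ᵐ x ∂μ, ∃ l, Tendsto (fun j => W j (x, t)) atTop (𝓝 l) := by
      refine Lp.ae_tendsto_of_cauchy_eLpNorm (p := 2) (f := fun j x => W j (x, t))
        (fun j => hWm j t) (by norm_num) (B := fun j => 2 * 2⁻¹ ^ j) ?_ ?_
      · rw [ENNReal.tsum_mul_left, ENNReal.tsum_geometric]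
        simp [ENNReal.mul_eq_top]
      · intro N n m hn hm
        have e : ((fun x => W n (x, t)) - fun x => W m (x, t)) =ᵐ[μ] (p n t - p m t : L2Unit) := by
          filter_upwards [Lp.coeFn_sub (p n t) (p m t), hpW n t, hpW m t] with x h1 h2 h3
          rw [h1, Pi.sub_apply, Pi.sub_apply, h2, h3]
        rw [eLpNorm_congr_ae e, ← Lp.enorm_def, two_mul,
          show p n t - p m t = (u t - p m t) - (u t - p n t) by abel]
        refine (enorm_sub_le).trans_lt (ENNReal.add_lt_add ?_ ?_)
        · exact (hup m t ht).trans_le (pow_le_pow_right_of_le_one' (by simp) hm)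
        · exact (hup n t ht).trans_le (pow_le_pow_right_of_le_one' (by simp) hn)
    -- This only identifies the limit: a further subsequence tends almost everywhere to the `L²`
    -- sum.
    have h2 : TendstoInMeasure μ (fun j x => W j (x, t)) atTop (u t) := by
      refine tendstoInMeasure_of_tendsto_eLpNorm (p := 2) (by norm_num) (fun j => hWm j t)
        (Lp.aestronglyMeasurable _) ?_
      have e : ∀ j, eLpNorm ((fun x => W j (x, t)) - fun x => u t x) 2 μ = ‖u t - p j t‖ₑ := by
        intro j
        rw [enorm_sub_rev, Lp.enorm_def]
        refine eLpNorm_congr_ae ?_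
        filter_upwards [Lp.coeFn_sub (p j t) (u t), hpW j t] with x h1 h2
        rw [h1, Pi.sub_apply, Pi.sub_apply, h2]
      simp only [e]
      exact tendsto_of_tendsto_of_tendsto_of_le_of_le tendsto_const_nhds
        (ENNReal.tendsto_pow_atTop_nhds_zero_of_lt_one (r := 2⁻¹) (by simp))
        (fun _ => zero_le) fun j => (hup j t ht).le
    obtain ⟨ns, hns, hns2⟩ := h2.exists_seq_tendsto_ae
    filter_upwards [h1, hns2] with x ⟨l, hl⟩ hx
    rwa [tendsto_nhds_unique hx (hl.comp hns.tendsto_atTop)]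
  refine ⟨fun z => limUnder atTop fun j => W j z, fun t ht => (hlim t ht).mono fun x hx =>
    hx.limUnder_eq, (StronglyMeasurable.limUnder fun j =>
      (hW j).stronglyMeasurable).aestronglyMeasurable, ?_⟩
  -- Measurability of the convergence set permits Fubini, passing from almost every `x` at each `t`
  -- to almost every `(x,t)`, as Fatou requires.
  have hmeas : MeasurableSet {z : ℝ × ℝ | ∃ l, Tendsto (fun j => W j z) atTop (𝓝 l)} :=
    measurableSet_exists_tendsto fun j => (hW j).measurable
  have hae : ∀ᵐ z ∂(volume.restrict (Ioo (0 : ℝ) 1 ×ˢ Ioo 0 T)),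
      ∃ l, Tendsto (fun j => W j z) atTop (𝓝 l) := by
    rw [Measure.volume_eq_prod, ← Measure.prod_restrict, Measure.ae_prod_iff_ae_ae hmeas,
      Measure.ae_ae_comm hmeas]
    filter_upwards [ae_restrict_mem measurableSet_Ioo] with t ht
    exact (hlim t (Ioo_subset_Icc_self ht)).mono fun x hx => ⟨_, hx⟩
  refine (Lp.eLpNorm_lim_le_liminf_eLpNorm (f := W) (fun j => (hW j).aestronglyMeasurable) _
    (hae.mono fun z hz => tendsto_nhds_limUnder hz)).trans ?_
  exact Filter.liminf_le_of_frequently_le' (.of_forall fun j => hQ _)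

end Series

end

/-! ### Independence of the representative, and the main theorem. -/

noncomputable section

theorem continuous_modeCoeff {P : ℝ} {M : ℕ} (hP : 0 < P) (hM : 1 ≤ M) {a : ℤ → ℂ}
    (ha : halfEnergy a ≠ ∞) (n : ℕ) : Continuous (modeCoeff P M a n) := by
  unfold modeCoeff
  refine Continuous.add ?_ ?_
  · exact (Complex.continuous_ofReal.mul continuous_const).mul (continuous_phase P _)
  · refine continuous_tsum (fun k => continuous_const.mul
      ((continuous_phase P k).sub (continuous_phase P _)))
      ((summable_duhamelCoeff hP hM ha n).mul_right 2) fun k t => ?_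
    rw [norm_mul]
    gcongr
    refine (norm_sub_le _ _).trans_eq ?_
    rw [norm_phase, norm_phase]
    norm_num

theorem boundaryCoeff_congr {T : ℝ} {h g : ℝ → ℂ} (hg : h =ᵐ[volume.restrict (Ioo 0 T)] g)
    (n : ℕ) {t : ℝ} (ht : t ∈ Icc 0 T) : boundaryCoeff h n t = boundaryCoeff g n t := by
  unfold boundaryCoeff
  congr 1
  rw [intervalIntegral.integral_of_le ht.1, intervalIntegral.integral_of_le ht.1,
    integral_Ioc_eq_integral_Ioo, integral_Ioc_eq_integral_Ioo]
  refine integral_congr_ae ?_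
  filter_upwards [ae_restrict_of_ae_restrict_of_subset (Ioo_subset_Ioo_right ht.2) hg] with τ hτ
  rw [hτ]

theorem eSobolevHalfNorm_congr {T : ℝ} {h g : ℝ → ℂ}
    (hg : h =ᵐ[volume.restrict (Ioo 0 T)] g) : eSobolevHalfNorm T h = eSobolevHalfNorm T g := by
  unfold eSobolevHalfNorm
  congr 2
  · exact lintegral_congr_ae (hg.mono fun t ht => by simp only [ht])
  · refine lintegral_congr_ae (hg.mono fun t ht => ?_)
    exact lintegral_congr_ae (hg.mono fun s hs => by simp only [ht, hs])

end

theorem proposition4p6 (T : ℝ) (hT : 0 < T) :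
    ∃ C : ℝ≥0, ∀ h : ℝ → ℂ, MemSobolevHalf T h →
      -- the series defining `u_h(·,t)` converges in `L²(0,1)` for every `t ∈ [0,T]`
      (∀ t ∈ Icc 0 T, Summable fun n : ℕ => boundaryCoeff h n t • sineMode n) ∧
      -- `u_h ∈ C([0,T]; L²(0,1))`, with the bound on the supremum over `t`
      ContinuousOn (boundaryIntegral h) (Icc 0 T) ∧
      (⨆ t ∈ Icc 0 T, ‖boundaryIntegral h t‖ₑ) ≤ C * eSobolevHalfNorm T h ∧
      -- `u_h`, as a function `U` of `(x,t)`, is in `L⁴((0,1) × (0,T))`, with the bound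
      ∃ U : ℝ × ℝ → ℂ,
        (∀ t ∈ Icc 0 T, ∀ᵐ x ∂(volume.restrict (Ioo (0 : ℝ) 1)),
          U (x, t) = boundaryIntegral h t x) ∧
        MemLp U 4 (volume.restrict (Ioo (0 : ℝ) 1 ×ˢ Ioo 0 T)) ∧
        eLpNorm U 4 (volume.restrict (Ioo (0 : ℝ) 1 ×ˢ Ioo 0 T)) ≤
          C * eSobolevHalfNorm T h := by
  -- The least `M` for which `2M/π ≥ 2T`.
  set M : ℕ := ⌈Real.pi * T⌉₊
  have hπT : 0 < Real.pi * T := mul_pos Real.pi_pos hT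
  have hM : 1 ≤ M := Nat.one_le_iff_ne_zero.2 (Nat.ceil_pos.2 hπT).ne'
  set P : ℝ := 2 * M / Real.pi with hPM
  have hTP : 2 * T ≤ P := by
    rw [hPM, le_div_iff₀ Real.pi_pos]
    linarith [Nat.le_ceil (Real.pi * T)]
  have hP : 0 < P := by linarith
  have : Fact (0 < P) := ⟨hP⟩
  obtain ⟨C₁, hC₁⟩ := exists_halfEnergy_tentExtension_le (P := P) hT hTP
  obtain ⟨C₂, hC₂⟩ := exists_modeCoeff_bound hP hM T
  obtain ⟨C₃, hC₃⟩ := exists_eLpNorm_modeCoeff_le hP hM (T := T) (by linarith)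
  refine ⟨(C₂ * C₁) ^ (1 / 2 : ℝ) + C₃ * C₁ ^ (1 / 2 : ℝ), fun h hh => ?_⟩
  -- The extension lemmas need a measurable function everywhere; the coefficients and the norm do
  -- not see the change.
  set g := hh.1.mk h
  have hg : h =ᵐ[volume.restrict (Ioo 0 T)] g := hh.1.ae_eq_mk
  have hgm : Measurable g := hh.1.stronglyMeasurable_mk.measurable
  have hE : eSobolevHalfNorm T g ≠ ∞ := by
    rw [← eSobolevHalfNorm_congr hg]
    exact hh.2.ne
  set a := fourierCoeff (tentExtension T P g)
  have ha : halfEnergy a ≤ C₁ * eSobolevHalfNorm T h ^ 2 := by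
    rw [eSobolevHalfNorm_congr hg]
    exact hC₁ g hgm hE
  have hat : halfEnergy a ≠ ∞ := by
    have := hh.2.ne
    exact ne_top_of_le_ne_top (by finiteness) ha
  have hsqrt : halfEnergy a ^ (1 / 2 : ℝ) ≤ (C₁ ^ (1 / 2 : ℝ) : ℝ≥0) * eSobolevHalfNorm T h := by
    refine (ENNReal.rpow_le_rpow ha (by norm_num)).trans_eq ?_
    rw [ENNReal.mul_rpow_of_nonneg _ _ (by norm_num), ENNReal.sq_rpow_half,
      ENNReal.coe_rpow_of_nonneg _ (by norm_num)]
  have hcoeff : ∀ n, ∀ t ∈ Icc 0 T, boundaryCoeff h n t = modeCoeff P M a n t := fun n t ht => by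
    rw [boundaryCoeff_congr hg n ht]
    exact boundaryCoeff_eq_modeCoeff hM hPM hT hTP hgm hE n ht
  have hseries : ∀ t ∈ Icc 0 T, boundaryIntegral h t = ∑' n, modeCoeff P M a n t • sineMode n :=
    fun t ht => tsum_congr fun n => by rw [hcoeff n t ht]
  obtain ⟨γ, hb, hγ⟩ := hC₂ a
  have hγt : ∑' n, γ n ^ 2 ≠ ∞ := ne_top_of_le_ne_top (by finiteness) hγ
  have hc := continuous_modeCoeff hP hM hat
  have hγs : (∑' n, γ n ^ 2) ^ (1 / 2 : ℝ) ≤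
      ((C₂ * C₁) ^ (1 / 2 : ℝ) : ℝ≥0) * eSobolevHalfNorm T h := by
    refine (ENNReal.rpow_le_rpow hγ (by norm_num)).trans ?_
    rw [NNReal.mul_rpow, ENNReal.coe_mul, mul_assoc,
      ENNReal.mul_rpow_of_nonneg _ _ (by norm_num), ENNReal.coe_rpow_of_nonneg _ (by norm_num)]
    gcongr
  obtain ⟨U, hU, hUm, hUb⟩ := exists_joint_representative hc hb hγt (hC₃ a hat)
  have hUC : eLpNorm U 4 (volume.restrict (Ioo (0 : ℝ) 1 ×ˢ Ioo 0 T)) ≤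
      (((C₂ * C₁) ^ (1 / 2 : ℝ) + C₃ * C₁ ^ (1 / 2 : ℝ) : ℝ≥0) : ℝ≥0∞) *
        eSobolevHalfNorm T h := by
    refine (hUb.trans (mul_le_mul_right hsqrt _)).trans ?_
    rw [← mul_assoc, ← ENNReal.coe_mul]
    gcongr
    exact le_add_self
  refine ⟨fun t ht => ?_, ?_, ?_, U, fun t ht => ?_, ⟨hUm, ?_⟩, hUC⟩
  · simp only [hcoeff _ t ht]
    exact summable_series hb hγt ht
  · exact (continuousOn_series hc hb hγt).congr hseries
  · refine iSup₂_le fun t ht => ?_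
    rw [hseries t ht]
    refine ((enorm_series_le hb hγt ht).trans hγs).trans ?_
    gcongr
    exact le_self_add
  · rw [hseries t ht]
    exact hU t ht
  · refine hUC.trans_lt (ENNReal.mul_lt_top ENNReal.coe_lt_top hh.2)
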